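/- **Setting.** Let $V=\mathbb C^{N}$; for $X\in\mathrm{End}(V^{\otimes 2})$ let $X_i$ be $X$ acting on the tensor factors $i,i+1$ of $V^{\otimes n}$, and let $P$ be the flip. A *Yang–Baxter matrix* is $R\in\mathrm{Aut}(V^{\otimes2})$ with $R_1R_2R_1=R_2R_1R_2$. It is *skew invertible* if there is $\Psi_R\in\mathrm{End}(V^{\otimes2})$ with $\mathrm{Tr}_{(2)}R_1(\Psi_R)_2=\mathrm{Tr}_{(2)}(\Psi_R)_1R_2=P$ (then $D_R:=\mathrm{Tr}_{(2)}\Psi_R\in\mathrm{End}(V)$), and *strict skew invertible* if $R$ and $R^{-1}$ are both skew invertible. A pair $\{R,F\}$ of Yang–Baxter matrices is *compatible* if $R_1F_2F_1=F_2F_1R_2$ and $R_2F_1F_2=F_1F_2R_1$. For $q\in\mathbb C\setminus\{0,\pm1\}$ and $\mu\in\mathbb C\setminus\{0,q,-q^{-1}\}$ the Birman–Murakami–Wenzl algebra $\mathcal W_n(q,\mu)$ is generated by invertible $\sigma_1,\dots,\sigma_{n-1}$ with the braid relations and, for $\kappa_i=\frac{(q-\sigma_i)(q^{-1}+\sigma_i)}{\mu(q-q^{-1})}$,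 the relations $\sigma_i\kappa_i=\kappa_i\sigma_i=\mu\kappa_i$, $\kappa_i\sigma_{i\pm1}^{\epsilon}=\kappa_i\kappa_{i\pm1}\sigma_i^{-\epsilon}$, $\sigma_{i\pm1}^{\epsilon}\kappa_i=\sigma_i^{-\epsilon}\kappa_{i\pm1}\kappa_i$ ($\epsilon=\pm1$), $\kappa_i\kappa_{i\pm1}\kappa_i=\kappa_i$ and $\kappa_i^2=\eta\kappa_i$ with $\eta=\frac{(q-\mu)(q^{-1}+\mu)}{\mu(q-q^{-1})}$. $R$ is *of BMW type* if $\sigma_i\mapsto R_i$ extends to a representation $\rho_R$ of $\mathcal W_n(q,\mu)$ on $V^{\otimes n}$ for every $n$ and $\rho_R(\kappa_1)\neq0$ (that is, $\mu$ is an eigenvalue of $R$). Put $i_q=\frac{q^i-q^{-i}}{q-q^{-1}}$, $\sigma_i^-(x)=1+\frac{x-1}{q-q^{-1}}\sigma_i+\frac{\mu(x-1)}{\mu+qx}\kappa_i$, $a^{(1)}=1$ and $a^{(i+1)}=\frac{q^i}{(i+1)_q}a^{(i)}\sigma_i^-(q^{-2i})a^{(i)}$; $x^{\uparrow1}$ is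 the image of $x$ under $\sigma_i\mapsto\sigma_{i+1}$. $R$ is *orthogonal of type $O(k)$*, $k\ge2$, if it is a skew invertible Yang–Baxter matrix of BMW type with $\mu=q^{1-k}$, where $q^{2i}\ne1$ and $\mu\neq-q^{1-2i}$ for $1\le i\le k$, such that $\rho_R(a^{(i)})\ne0$ for $2\le i\le k$, $\rho_R(a^{(k)\uparrow1}\sigma_1^-(q^{-2k})a^{(k)\uparrow1})=0$, and $\mathrm{rk}\,\rho_R(a^{(k)})=1$. Let $\{R,F\}$ be a compatible pair of strict skew invertible Yang–Baxter matrices with $R$ of type $O(k)$. The *quantum matrix algebra* $\mathcal M(R,F)$ is the quotient of the free unital algebra $\mathbb C\langle M^a_b\rangle_{a,b=1}^N$ by the entries of $R_1M_{\overline1}M_{\overline2}=M_{\overline1}M_{\overline2}R_1$, where $M=\|M^a_b\|$, $M_{\overline1}=M_1$ and $M_{\overline{i+1}}=F_iM_{\overline i}F_i^{-1}$. Its *quantum determinant* is $$\mathfrak e_k=\mathrm{Tr}_{(1,\dots,k)}\bigl((D_R)_1\cdots(D_R)_k\,M_{\overline1}\cdots M_{\overline k}\,\rho_R(a^{(k)})\bigr).$$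 **Proposition.** Define $O,\widetilde O\in\mathrm{End}(V)$ by $$O_1=\frac{k_q(1+q^{2-k})}{q+q^{1-k}}\,\mathrm{Tr}_{(2,\dots,k+1)}\bigl(\rho_R(a^{(k)\uparrow1})F_1^{-1}F_2^{-1}\cdots F_k^{-1}\bigr),\qquad \widetilde O_1=\frac{k_q(1+q^{2-k})}{q+q^{1-k}}\,\mathrm{Tr}_{(2,\dots,k+1)}\bigl(F_k\cdots F_2F_1\,\rho_R(a^{(k)\uparrow1})\bigr).$$ Then (a) $M\,\mathfrak e_k=\mathfrak e_k\,(\widetilde O\,M\,O)$ in $\mathcal M(R,F)$, that is, $M^a_b\,\mathfrak e_k=\mathfrak e_k\,(\widetilde OMO)^a_b$ for all $a,b$; (b) $O\widetilde O=\widetilde OO=I$, so that $\widetilde O=O^{-1}$. -/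

import Mathlib

/-!
Throughout, `V = ℂ^N` with its standard basis.  An operator on `V^{⊗n}` (with coefficients in an
algebra `A`) is a matrix indexed by multi-indices `Fin n → Fin N`.  Tensor legs, and with them
the braid generators, are numbered from `0`: the leg called `i + 1` in the usual notation is `i`.
-/

namespace OrthQM

open Matrix

/-! ### Operators in tensor powers -/

/-- `End(V^{⊗n}) ⊗ A`, where `dim V = N`. -/
abbrev TensorOp (N n : ℕ) (A : Type*) := Matrix (Fin n → Fin N) (Fin n → Fin N) A

/-- The operator on `V^{⊗n}` acting as `X` on the legs `s, …, s + p - 1` and as the identity on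
all other legs, that is `I^{⊗s} ⊗ X ⊗ I^{⊗(n-s-p)}`; it is only used when `s + p ≤ n` (outside
this range the value is `0`). -/
def legs {N p : ℕ} {A : Type*} [Zero A] (X : TensorOp N p A) (n s : ℕ) : TensorOp N n A :=
  fun a b =>
    if h : s + p ≤ n then
      if ∀ j : Fin n, (j.1 < s ∨ s + p ≤ j.1) → a j = b j then
        X (fun t => a ⟨s + t.1, by omega⟩) (fun t => b ⟨s + t.1, by omega⟩)
      else 0
    else 0

/-- The trace over the leg `i`. -/
def ptrace {N n : ℕ} {A : Type*} [AddCommMonoid A] (i : Fin (n + 1)) (X : TensorOp N (n + 1) A) :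
    TensorOp N n A :=
  fun a b => ∑ c : Fin N, X (i.insertNth c a) (i.insertNth c b)

/-- The trace over all legs but the first, with values in `End(V) ⊗ A`. -/
def traceTail {N n : ℕ} {A : Type*} [AddCommMonoid A] (X : TensorOp N (n + 1) A) :
    Matrix (Fin N) (Fin N) A :=
  fun a b => ∑ c : Fin n → Fin N, X (Fin.cons a c) (Fin.cons b c)

/-- A numerical matrix viewed as a matrix with entries in a `ℂ`-algebra `A`. -/
def coeffs {ι : Type*} (A : Type*) [Semiring A] [Algebra ℂ A] (X : Matrix ι ι ℂ) : Matrix ι ι A :=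
  X.map (algebraMap ℂ A)

/-- The permutation operator `P (u ⊗ v) = v ⊗ u`. -/
def flipOp (N : ℕ) : TensorOp N 2 ℂ :=
  fun a b => if a 0 = b 1 ∧ a 1 = b 0 then 1 else 0

/-! ### The Birman–Murakami–Wenzl algebra -/

section BMW

variable {A : Type*} [Ring A] [Algebra ℂ A]

/-- `κ = (q - σ)(q⁻¹ + σ) / (μ (q - q⁻¹))`. -/
noncomputable def kappa (q μ : ℂ) (σ : A) : A :=
  (μ * (q - q⁻¹))⁻¹ • ((q • (1 : A) - σ) * (q⁻¹ • (1 : A) + σ))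

/-- `η = (q - μ)(q⁻¹ + μ) / (μ (q - q⁻¹))`. -/
noncomputable def eta (q μ : ℂ) : ℂ := (q - μ) * (q⁻¹ + μ) / (μ * (q - q⁻¹))

/-- The defining relations of the BMW algebra `W_n(q, μ)` on the images `σ i` of its generators
and the images `τ i` of their inverses, `0 ≤ i ≤ n - 2`.  They hold if and only if the assignment
of `σ i` to the generators extends to an algebra homomorphism `W_n(q, μ) → A`. -/
structure BMWRelations (q μ : ℂ) (n : ℕ) (σ τ : ℕ → A) : Prop where
  mul_inv : ∀ i, i + 1 < n → σ i * τ i = 1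
  inv_mul : ∀ i, i + 1 < n → τ i * σ i = 1
  braid : ∀ i, i + 2 < n → σ i * σ (i + 1) * σ i = σ (i + 1) * σ i * σ (i + 1)
  comm : ∀ i j, i + 1 < j → j + 1 < n → σ i * σ j = σ j * σ i
  sigma_kappa : ∀ i, i + 1 < n → σ i * kappa q μ (σ i) = μ • kappa q μ (σ i)
  kappa_sigma : ∀ i, i + 1 < n → kappa q μ (σ i) * σ i = μ • kappa q μ (σ i)
  kappa_adj : ∀ i j, i + 1 < n → j + 1 < n → (j = i + 1 ∨ i = j + 1) →
    kappa q μ (σ i) * σ j = kappa q μ (σ i) * kappa q μ (σ j) * τ i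
  kappa_adj_inv : ∀ i j, i + 1 < n → j + 1 < n → (j = i + 1 ∨ i = j + 1) →
    kappa q μ (σ i) * τ j = kappa q μ (σ i) * kappa q μ (σ j) * σ i
  adj_kappa : ∀ i j, i + 1 < n → j + 1 < n → (j = i + 1 ∨ i = j + 1) →
    σ j * kappa q μ (σ i) = τ i * kappa q μ (σ j) * kappa q μ (σ i)
  adj_inv_kappa : ∀ i j, i + 1 < n → j + 1 < n → (j = i + 1 ∨ i = j + 1) →
    τ j * kappa q μ (σ i) = σ i * kappa q μ (σ j) * kappa q μ (σ i)
  kappa_kappa_kappa : ∀ i j, i + 1 < n → j + 1 < n → (j = i + 1 ∨ i = j + 1) →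
    kappa q μ (σ i) * kappa q μ (σ j) * kappa q μ (σ i) = kappa q μ (σ i)
  kappa_sq : ∀ i, i + 1 < n →
    kappa q μ (σ i) * kappa q μ (σ i) = eta q μ • kappa q μ (σ i)

/-- The `q`-number `i_q = (q^i - q^{-i}) / (q - q⁻¹)`. -/
noncomputable def qNum (q : ℂ) (i : ℕ) : ℂ := (q ^ i - (q ^ i)⁻¹) / (q - q⁻¹)

/-- The baxterized element `σ⁻(x) = 1 + (x-1)/(q-q⁻¹) σ + μ(x-1)/(μ + q x) κ`. -/
noncomputable def baxterMinus (q μ x : ℂ) (σ : A) : A :=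
  1 + ((x - 1) / (q - q⁻¹)) • σ + (μ * (x - 1) / (μ + q * x)) • kappa q μ σ

/-- The `q`-antisymmetrizers: `a^{(1)} = 1` and
`a^{(i+1)} = q^i/(i+1)_q a^{(i)} σ_i⁻(q^{-2i}) a^{(i)}`, evaluated on the images `σ` of the
generators.  The shifted element `a^{(i)↑1}` is obtained from the shifted family
`fun j => σ (j + 1)`. -/
noncomputable def antisymm (q μ : ℂ) (σ : ℕ → A) : ℕ → A
  | 0 => 1
  | 1 => 1
  | i + 2 => (q ^ (i + 1) / qNum q (i + 2)) •
      (antisymm q μ σ (i + 1) * baxterMinus q μ ((q ^ (2 * (i + 1)))⁻¹) (σ i)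
        * antisymm q μ σ (i + 1))

end BMW

/-! ### Yang–Baxter matrices -/

section YangBaxter

variable {N : ℕ}

/-- The braid relation `R₁ R₂ R₁ = R₂ R₁ R₂` on `V^{⊗3}`. -/
def IsYangBaxter (R : (TensorOp N 2 ℂ)ˣ) : Prop :=
  legs R.1 3 0 * legs R.1 3 1 * legs R.1 3 0 = legs R.1 3 1 * legs R.1 3 0 * legs R.1 3 1

/-- `Tr₍₂₎ R₁ Ψ₂ = Tr₍₂₎ Ψ₁ R₂ = P`. -/
def IsSkewInverse (R Ψ : TensorOp N 2 ℂ) : Prop :=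
  ptrace 1 (legs R 3 0 * legs Ψ 3 1) = flipOp N ∧ ptrace 1 (legs Ψ 3 0 * legs R 3 1) = flipOp N

def IsSkewInvertible (R : (TensorOp N 2 ℂ)ˣ) : Prop := ∃ Ψ, IsSkewInverse R.1 Ψ

/-- Both `R` and `R⁻¹` are skew invertible. -/
def IsStrictSkewInvertible (R : (TensorOp N 2 ℂ)ˣ) : Prop :=
  IsSkewInvertible R ∧ IsSkewInvertible R⁻¹

/-- The matrix `D_R = Tr₍₂₎ Ψ_R` of a skew invertible `R` (the skew inverse `Ψ_R` is unique). -/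
noncomputable def dMatrix (R : (TensorOp N 2 ℂ)ˣ) (h : IsSkewInvertible R) :
    Matrix (Fin N) (Fin N) ℂ :=
  traceTail h.choose

/-- A compatible pair of strict skew invertible Yang–Baxter matrices. -/
structure IsCompatiblePair (R F : (TensorOp N 2 ℂ)ˣ) : Prop where
  yangBaxter_left : IsYangBaxter R
  yangBaxter_right : IsYangBaxter F
  strict_left : IsStrictSkewInvertible R
  strict_right : IsStrictSkewInvertible F
  twist₁ : legs R.1 3 0 * legs F.1 3 1 * legs F.1 3 0 = legs F.1 3 1 * legs F.1 3 0 * legs R.1 3 1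
  twist₂ : legs R.1 3 1 * legs F.1 3 0 * legs F.1 3 1 = legs F.1 3 0 * legs F.1 3 1 * legs R.1 3 0

/-- Yang–Baxter matrices of BMW type: `σ_i ↦ R_i` extends to a representation of `W_n(q, μ)` on
`V^{⊗n}` for every `n`, and `μ` is actually a spectral value of `R`, that is, the image `K` of
`κ` does not vanish (when `K = 0` the matrix `R` is of Hecke type and `μ` is arbitrary). -/
structure IsBMWType (q μ : ℂ) (R : (TensorOp N 2 ℂ)ˣ) : Prop where
  q_ne : q ≠ 0 ∧ q ≠ 1 ∧ q ≠ -1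
  mu_ne : μ ≠ 0 ∧ μ ≠ q ∧ μ ≠ -q⁻¹
  relations : ∀ n, BMWRelations q μ n (legs R.1 n) (legs (R⁻¹).1 n)
  kappa_ne_zero : kappa q μ R.1 ≠ 0

/-- `ρ_R(a^{(k)})` on `V^{⊗k}`. -/
noncomputable def antisymmOp (q μ : ℂ) (R : (TensorOp N 2 ℂ)ˣ) (k : ℕ) : TensorOp N k ℂ :=
  antisymm q μ (legs R.1 k) k

/-- `ρ_R(a^{(k)↑1})` on `V^{⊗(k+1)}`. -/
noncomputable def antisymmShiftOp (q μ : ℂ) (R : (TensorOp N 2 ℂ)ˣ) (k : ℕ) :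
    TensorOp N (k + 1) ℂ :=
  antisymm q μ (fun j => legs R.1 (k + 1) (j + 1)) k

/-- Skew invertible Yang–Baxter matrices of BMW type of height `k`. -/
structure HasHeight (q μ : ℂ) (k : ℕ) (R : (TensorOp N 2 ℂ)ˣ) : Prop where
  two_le : 2 ≤ k
  bmw : IsBMWType q μ R
  skew : IsSkewInvertible R
  q_pow_ne : ∀ i, 1 ≤ i → i ≤ k → q ^ (2 * i) ≠ 1
  mu_ne : ∀ i, 1 ≤ i → i ≤ k → μ ≠ -q ^ (1 - 2 * (i : ℤ))
  rank_ne : ∀ i, 2 ≤ i → i ≤ k → (antisymmOp q μ R i).rank ≠ 0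
  vanish : antisymmShiftOp q μ R k * baxterMinus q μ ((q ^ (2 * k))⁻¹) (legs R.1 (k + 1) 0)
    * antisymmShiftOp q μ R k = 0

/-- The value `μ = q^{1-k}`. -/
noncomputable def muO (q : ℂ) (k : ℕ) : ℂ := q ^ (1 - (k : ℤ))

/-- Orthogonal Yang–Baxter matrices of type `O(k)`. -/
structure IsOrthogonal (q : ℂ) (k : ℕ) (R : (TensorOp N 2 ℂ)ˣ) : Prop where
  height : HasHeight q (muO q k) k R
  rank_one : (antisymmOp q (muO q k) R k).rank = 1

end YangBaxter

/-! ### Quantum matrix algebras -/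

section QuantumMatrix

variable {N : ℕ}

/-- The copies `M_{\bar 1} = M₁`, `M_{\overline{i+1}} = F_i M_{\bar i} F_i⁻¹` of a matrix `M`, as
operators on `n` legs (`copy F M n i` is the copy number `i + 1`, for `i < n`). -/
noncomputable def copy {A : Type*} [Ring A] [Algebra ℂ A] (F : (TensorOp N 2 ℂ)ˣ)
    (M : Matrix (Fin N) (Fin N) A) (n : ℕ) : ℕ → TensorOp N n A
  | 0 => legs (p := 1) (fun a b => M (a 0) (b 0)) n 0
  | i + 1 => coeffs A (legs F.1 n i) * copy F M n i * coeffs A (legs (F⁻¹).1 n i)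

/-- The matrix of generators of the free algebra `ℂ⟨M^a_b⟩`. -/
noncomputable def freeMatrix (N : ℕ) :
    Matrix (Fin N) (Fin N) (FreeAlgebra ℂ (Fin N × Fin N)) :=
  fun a b => FreeAlgebra.ι ℂ (a, b)

/-- The entries of the matrix relation `R₁ M_{\bar 1} M_{\bar 2} = M_{\bar 1} M_{\bar 2} R₁`. -/
inductive QMRel (R F : (TensorOp N 2 ℂ)ˣ) :
    FreeAlgebra ℂ (Fin N × Fin N) → FreeAlgebra ℂ (Fin N × Fin N) → Prop
  | entry (a b : Fin 2 → Fin N) : QMRel R F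
      ((coeffs (FreeAlgebra ℂ (Fin N × Fin N)) R.1
        * copy F (freeMatrix N) 2 0 * copy F (freeMatrix N) 2 1 :
          TensorOp N 2 (FreeAlgebra ℂ (Fin N × Fin N))) a b)
      ((copy F (freeMatrix N) 2 0 * copy F (freeMatrix N) 2 1
        * coeffs (FreeAlgebra ℂ (Fin N × Fin N)) R.1 :
          TensorOp N 2 (FreeAlgebra ℂ (Fin N × Fin N))) a b)

/-- The quantum matrix algebra `M(R, F)`. -/
def QMAlgebra (R F : (TensorOp N 2 ℂ)ˣ) : Type := RingQuot (QMRel R F)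

noncomputable instance (R F : (TensorOp N 2 ℂ)ˣ) : Ring (QMAlgebra R F) :=
  inferInstanceAs (Ring (RingQuot (QMRel R F)))

noncomputable instance (R F : (TensorOp N 2 ℂ)ˣ) : Algebra ℂ (QMAlgebra R F) :=
  inferInstanceAs (Algebra ℂ (RingQuot (QMRel R F)))

/-- The quantum matrix `M`, whose entries are the generators of `M(R, F)`. -/
noncomputable def quantumMatrix (R F : (TensorOp N 2 ℂ)ˣ) :
    Matrix (Fin N) (Fin N) (QMAlgebra R F) :=
  fun a b => RingQuot.mkAlgHom ℂ (QMRel R F) (freeMatrix N a b)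

/-- The `R`-trace over all `n` legs, `Σ_{a,b} (∏_j D^{a_j}_{b_j}) X^b_a` with `D = D_R`. -/
noncomputable def rTrace {A : Type*} [Ring A] [Algebra ℂ A] (D : Matrix (Fin N) (Fin N) ℂ)
    {n : ℕ} (X : TensorOp N n A) : A :=
  ∑ a : Fin n → Fin N, ∑ b : Fin n → Fin N, (∏ j, D (a j) (b j)) • X b a

/-- The quantum determinant
`e_k = Tr_R₍₁,…,ₖ₎ (M_{\bar 1} ⋯ M_{\bar k} ρ_R(a^{(k)}))` for `μ = q^{1-k}`. -/
noncomputable def quantumDet (q : ℂ) (k : ℕ) (R F : (TensorOp N 2 ℂ)ˣ) (h : IsSkewInvertible R) :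
    QMAlgebra R F :=
  rTrace (dMatrix R h)
    (((List.range k).map (copy F (quantumMatrix R F) k)).prod
      * coeffs (QMAlgebra R F) (antisymmOp q (muO q k) R k))

/-- The scalar `k_q (1 + q^{2-k}) / (q + q^{1-k})`. -/
noncomputable def oFactor (q : ℂ) (k : ℕ) : ℂ :=
  qNum q k * (1 + q ^ (2 - (k : ℤ))) / (q + q ^ (1 - (k : ℤ)))

/-- The operator
`O = k_q (1 + q^{2-k}) / (q + q^{1-k}) Tr₍₂,…,ₖ₊₁₎ (ρ_R(a^{(k)↑1}) F₁⁻¹ F₂⁻¹ ⋯ Fₖ⁻¹)`. -/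
noncomputable def opO (q : ℂ) (k : ℕ) (R F : (TensorOp N 2 ℂ)ˣ) : Matrix (Fin N) (Fin N) ℂ :=
  oFactor q k • traceTail (antisymmShiftOp q (muO q k) R k
    * ((List.range k).map (legs (F⁻¹).1 (k + 1))).prod)

/-- The operator
`O⁻¹ = k_q (1 + q^{2-k}) / (q + q^{1-k}) Tr₍₂,…,ₖ₊₁₎ (Fₖ ⋯ F₂ F₁ ρ_R(a^{(k)↑1}))`. -/
noncomputable def opOInv (q : ℂ) (k : ℕ) (R F : (TensorOp N 2 ℂ)ˣ) : Matrix (Fin N) (Fin N) ℂ :=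
  oFactor q k • traceTail (((List.range k).reverse.map (legs F.1 (k + 1))).prod
    * antisymmShiftOp q (muO q k) R k)

end QuantumMatrix

end OrthQM

/-! Write a for ρ_R(a^{(k)}) on legs 1..k of V^{⊗(k+1)}, a' for its shift to legs 2..k+1, and c for
`oFactor`. Since a is an idempotent of rank one, a' = U V with U = · ⊗ u : V → V^{⊗(k+1)}, V a
contraction with v, and V U = 1. Partial traces against a' become products through V: with Θ =
F_k⋯F_1, Θ' = Θ⁻¹, Õ = c·VΘU and O = c·VΘ'U.

The scalar heart is c² a' a a' = a' (`IsOrthogonal.shift_mul_mul_shift`). Adding a leg on the left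
writes a as a multiple of b σ⁻(q^{2-2k}) b, where b is absorbed by a', so only a', a'σ₁a' and a'κ₁a'
occur. The height condition a'σ⁻(q^{-2k})a' = 0 determines a'σ₁a' once a'κ₁a' is known. The latter
is a multiple of a': a'κ₁a' equals a one-leg operator times a', κ₁a'κ₁ is known by closing a leg,
and κ₁a' annihilates no nonzero one-leg operator (`Generic.eq_zero_of_kappa_mul`). The algebra
behind this is that a^{(i)} is a two-sided eigenvector of each of its σ_j with eigenvalue -q⁻¹
(`Generic.sigma_antisymm`), by the Yang–Baxter equation for σ⁻(x).

Compatibility gives Θ a' = a Θ. Hence ÕO = c² VΘa'Θ'U = c² V a U = 1, which is (b).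

For (a), M_{\bar 1}⋯M_{\bar k} commutes with the rank one idempotent and so acts on it as a single
element m of the algebra; the determinant is a complex multiple of m. Let T be the product of k+1
copies. Splitting off the first copy gives V T a' U = M m, because the other k copies are conjugate
to the first k under F_1⋯F_k. Splitting off the last copy ΘM₁Θ' gives V T a U = m (VΘU) M (VΘ'U). As
T commutes with a', the identity c² a' a a' = a' identifies c² V T a U with V T a' U. -/

namespace OrthQM
open Matrix

/-! ### Consequences of the BMW relations; the Baxterized Yang–Baxter equation -/

section BMW
variable {A : Type*} [Ring A] [Algebra ℂ A] {q μ : ℂ}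

theorem sigma_sq (hq : q - q⁻¹ ≠ 0) (hμ : μ ≠ 0) (σ : A) :
    σ * σ = (1 : ℂ) • (1 : A) + (q - q⁻¹) • σ - ((q - q⁻¹) * μ) • kappa q μ σ := by
  have hq0 : q ≠ 0 := by rintro rfl; simp at hq
  have h : q * q⁻¹ = 1 := mul_inv_cancel₀ hq0
  unfold kappa
  rw [smul_smul, mul_comm (q - q⁻¹) μ, mul_inv_cancel₀ (mul_ne_zero hμ hq)]
  simp only [sub_mul, mul_add, smul_mul_assoc, mul_smul_comm, mul_one, one_mul]
  match_scalars
  · ring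
  · linear_combination h
  · ring

theorem BMWRelations.kappa_inv {n : ℕ} {σ τ : ℕ → A} (h : BMWRelations q μ n σ τ)
    (hμ : μ ≠ 0) {i : ℕ} (hi : i + 1 < n) :
    kappa q μ (σ i) * τ i = μ⁻¹ • kappa q μ (σ i) := by
  have h1 := congrArg (μ⁻¹ • · * τ i) (h.kappa_sigma i hi)
  simp only [smul_smul, inv_mul_cancel₀ hμ, one_smul, smul_mul_assoc, mul_assoc, h.mul_inv i hi,
    mul_one] at h1
  exact h1.symm

/-- The quadratic relation multiplied by σ⁻¹. It makes inverse generators polynomial, so that they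
can be eliminated from the relations between neighbours. -/
theorem BMWRelations.inv_eq {n : ℕ} {σ τ : ℕ → A} (h : BMWRelations q μ n σ τ)
    (hq : q - q⁻¹ ≠ 0) (hμ : μ ≠ 0) {i : ℕ} (hi : i + 1 < n) :
    τ i = σ i - (q - q⁻¹) • (1 : A) + (q - q⁻¹) • kappa q μ (σ i) := by
  have h1 := congrArg (· * τ i) (sigma_sq hq hμ (σ i))
  rw [mul_assoc, h.mul_inv i hi, sub_mul, add_mul] at h1
  simp only [smul_mul_assoc, mul_one, one_mul, h.mul_inv i hi, h.kappa_inv hμ hi, smul_smul,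
    one_smul, mul_assoc, mul_inv_cancel₀ hμ] at h1
  rw [eq_sub_iff_add_eq, ← sub_eq_iff_eq_add] at h1
  rw [← h1]; abel

theorem BMWRelations.inv_kappa {n : ℕ} {σ τ : ℕ → A} (h : BMWRelations q μ n σ τ)
    (hμ : μ ≠ 0) {i : ℕ} (hi : i + 1 < n) :
    τ i * kappa q μ (σ i) = μ⁻¹ • kappa q μ (σ i) := by
  have h1 := congrArg (fun x => μ⁻¹ • (τ i * x)) (h.sigma_kappa i hi)
  simp only [smul_smul, inv_mul_cancel₀ hμ, one_smul, mul_smul_comm, ← mul_assoc, h.inv_mul i hi,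
    one_mul] at h1
  exact h1.symm

theorem BMWRelations.kappa_sigma_kappa {n : ℕ} {σ τ : ℕ → A} (h : BMWRelations q μ n σ τ)
    (hμ : μ ≠ 0) {i j : ℕ} (hi : i + 1 < n) (hj : j + 1 < n) (hij : j = i + 1 ∨ i = j + 1) :
    kappa q μ (σ i) * (σ j * kappa q μ (σ i)) = μ⁻¹ • kappa q μ (σ i) := by
  rw [← mul_assoc, h.kappa_adj i j hi hj hij, mul_assoc, h.inv_kappa hμ hi, mul_smul_comm,
    h.kappa_kappa_kappa i j hi hj hij]

/-- The spectral-parameter Yang–Baxter equation. -/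
theorem BMWRelations.baxter_yang_baxter {n : ℕ} {σ τ : ℕ → A} (h : BMWRelations q μ n σ τ)
    (hq : q - q⁻¹ ≠ 0) (hμ : μ ≠ 0) {i : ℕ} (hi : i + 2 < n) {x y z : ℂ} (hz : z = x * y)
    (hx : μ + q * x ≠ 0) (hy : μ + q * y ≠ 0) (hxy : μ + q * z ≠ 0) :
    baxterMinus q μ x (σ i) * baxterMinus q μ z (σ (i + 1)) * baxterMinus q μ y (σ i) =
      baxterMinus q μ y (σ (i + 1)) * baxterMinus q μ z (σ i) *
        baxterMinus q μ x (σ (i + 1)) := by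
  have hi1 : i + 1 < n := by omega
  have hi2 : i + 1 + 1 < n := by omega
  have hq0 : q ≠ 0 := by rintro rfl; simp at hq
  have hss := sigma_sq hq hμ (σ i)
  have htt := sigma_sq hq hμ (σ (i + 1))
  have hsk := h.sigma_kappa i hi1
  have hks := h.kappa_sigma i hi1
  have htl := h.sigma_kappa (i + 1) hi2
  have hlt := h.kappa_sigma (i + 1) hi2
  have hkk := h.kappa_sq i hi1
  have hll := h.kappa_sq (i + 1) hi2
  have hs' := h.inv_eq hq hμ hi1
  have ht' := h.inv_eq hq hμ hi2
  have hbr := h.braid i hi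
  have hklk := h.kappa_kappa_kappa i (i + 1) hi1 hi2 (Or.inl rfl)
  have hlkl := h.kappa_kappa_kappa (i + 1) i hi2 hi1 (Or.inr rfl)
  have hktk := h.kappa_sigma_kappa hμ hi1 hi2 (Or.inl rfl)
  have hlsl := h.kappa_sigma_kappa hμ hi2 hi1 (Or.inr rfl)
  have hkt := h.kappa_adj i (i + 1) hi1 hi2 (Or.inl rfl)
  have hls := h.kappa_adj (i + 1) i hi2 hi1 (Or.inr rfl)
  have htk := h.adj_kappa i (i + 1) hi1 hi2 (Or.inl rfl)
  have hsl := h.adj_kappa (i + 1) i hi2 hi1 (Or.inr rfl)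
  have hkt' := h.kappa_adj_inv i (i + 1) hi1 hi2 (Or.inl rfl)
  have hls' := h.kappa_adj_inv (i + 1) i hi2 hi1 (Or.inr rfl)
  have htk' := h.adj_inv_kappa i (i + 1) hi1 hi2 (Or.inl rfl)
  have hsl' := h.adj_inv_kappa (i + 1) i hi2 hi1 (Or.inr rfl)
  have hss' := h.mul_inv i hi1
  have hs's := h.inv_mul i hi1
  have htt' := h.mul_inv (i + 1) hi2
  have ht't := h.inv_mul (i + 1) hi2
  unfold baxterMinus
  generalize kappa q μ (σ i) = k at *
  generalize kappa q μ (σ (i + 1)) = l at *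
  generalize σ i = s at *
  generalize σ (i + 1) = t at *
  generalize τ i = s' at *
  generalize τ (i + 1) = t' at *
  -- The identities e1–e9 are rewriting rules bringing cubic words in s, t, k, l to a normal form.
  -- In particular e9 trades s l s for t k t, after which equality can be tested coefficient by
  -- coefficient.
  have e1 : s * (t * k) = l * k := by rw [htk, mul_assoc, ← mul_assoc s, hss', one_mul]
  have e2 : k * (t * s) = k * l := by rw [← mul_assoc, hkt, mul_assoc, hs's, mul_one]
  have e3 : t * (s * l) = k * l := by rw [hsl, mul_assoc, ← mul_assoc t, htt', one_mul]
  have e4 : l * (s * t) = l * k := by rw [← mul_assoc, hls, mul_assoc, ht't, mul_one]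
  have e5 : k * (l * s) = k * t - (q - q⁻¹) • k + (q - q⁻¹) • (k * l) := by
    rw [← mul_assoc, ← hkt', ht', mul_add, mul_sub, mul_smul_comm, mul_smul_comm, mul_one]
  have e6 : l * (k * t) = l * s - (q - q⁻¹) • l + (q - q⁻¹) • (l * k) := by
    rw [← mul_assoc, ← hls', hs', mul_add, mul_sub, mul_smul_comm, mul_smul_comm, mul_one]
  have e7 : s * (l * k) = t * k - (q - q⁻¹) • k + (q - q⁻¹) • (l * k) := by
    rw [← mul_assoc, ← htk', ht', add_mul, sub_mul, smul_mul_assoc, smul_mul_assoc, one_mul]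
  have e8 : t * (k * l) = s * l - (q - q⁻¹) • l + (q - q⁻¹) • (k * l) := by
    rw [← mul_assoc, ← hsl', hs', add_mul, sub_mul, smul_mul_assoc, smul_mul_assoc, one_mul]
  have e9 : s * (l * s) = t * (k * t) - (q - q⁻¹) • (t * k) - (q - q⁻¹) • (k * t)
      + (q - q⁻¹) • (s * l) + (q - q⁻¹) • (l * s) + ((q - q⁻¹) * (q - q⁻¹)) • k
      - ((q - q⁻¹) * (q - q⁻¹)) • l := by
    rw [← mul_assoc, hsl, mul_assoc, mul_assoc, e5, ht']
    simp only [add_mul, sub_mul, mul_add, mul_sub, smul_mul_assoc, mul_smul_comm, one_mul,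
      ← mul_assoc, hlkl]
    simp only [mul_assoc, e8, e6]
    module
  rw [mul_assoc] at hklk hlkl hbr
  rw [mul_assoc] at hbr
  -- The denominators are kept as atoms while fractions are cleared, so that their nonvanishing is
  -- recognized; they are expanded only at the end.
  generalize hdx : μ + q * x = dx at *
  generalize hdy : μ + q * y = dy at *
  generalize hdz : μ + q * z = dz at *
  simp only [mul_add, add_mul, smul_mul_assoc, mul_smul_comm, mul_one, one_mul, smul_smul,
    mul_assoc, hss, htt, hsk, hks, htl, hlt, hkk, hll, hklk, hlkl, hktk, hlsl, hbr, e1, e2, e3, e4,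
    e5, e6, e7, e8, e9, eta, mul_sub]
  have hq2 : q ^ 2 - 1 ≠ 0 := fun h0 => hq (by field_simp; rw [h0, mul_zero])
  match_scalars <;> field_simp <;> subst hdx hdy hdz hz <;> ring1
end BMW

/-! ### Antisymmetrizers: eigenvector property, recursions, closing a leg -/

section BMW
variable {A : Type*} [Ring A] [Algebra ℂ A] {q μ : ℂ}

/-- The conditions on the parameters under which `a^{(i)}` is defined for `i ≤ k + 1`. -/
structure Generic (q μ : ℂ) (k : ℕ) : Prop where
  two_le : 2 ≤ k
  q_ne : q ≠ 0
  mu_ne : μ ≠ 0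
  pow_ne : ∀ i, 1 ≤ i → i ≤ k → q ^ (2 * i) ≠ 1
  denom_ne : ∀ i, 1 ≤ i → i ≤ k → μ + q * (q ^ (2 * i))⁻¹ ≠ 0

theorem Generic.sub_inv_ne {k : ℕ} (g : Generic q μ k) : q - q⁻¹ ≠ 0 := by
  have h0 := g.q_ne
  have h := g.pow_ne 1 le_rfl (by have := g.two_le; omega)
  intro h1
  apply h
  field_simp at h1
  linear_combination h1

theorem Generic.qNum_ne {k : ℕ} (g : Generic q μ k) {i : ℕ} (h1 : 1 ≤ i) (hi : i ≤ k) :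
    qNum q i ≠ 0 := by
  refine div_ne_zero (fun h => g.pow_ne i h1 hi ?_) g.sub_inv_ne
  have h0 : q ^ i ≠ 0 := pow_ne_zero _ g.q_ne
  field_simp at h
  rw [mul_comm, pow_mul]
  linear_combination h

theorem kappa_commute {x σ : A} (h : Commute x σ) : Commute x (kappa q μ σ) :=
  (((Commute.one_right x).smul_right q |>.sub_right h).mul_right
    (((Commute.one_right x).smul_right q⁻¹).add_right h)).smul_right _

theorem baxterMinus_commute {x σ : A} (y : ℂ) (h : Commute x σ) :
    Commute x (baxterMinus q μ y σ) :=
  ((Commute.one_right x).add_right (h.smul_right _)).add_right ((kappa_commute h).smul_right _)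

theorem antisymm_commute {x : A} {σ : ℕ → A} :
    ∀ j : ℕ, (∀ i, i + 1 < j → Commute x (σ i)) → Commute x (antisymm q μ σ j)
  | 0, _ => Commute.one_right x
  | 1, _ => Commute.one_right x
  | j + 2, h => by
    have ih := antisymm_commute (j + 1) fun i hi => h i (by omega)
    exact ((ih.mul_right (baxterMinus_commute _ (h j (by omega)))).mul_right ih).smul_right _

theorem antisymm_congr {σ σ' : ℕ → A} :
    ∀ j : ℕ, (∀ i, i + 1 < j → σ i = σ' i) → antisymm q μ σ j = antisymm q μ σ' j
  | 0, _ => rfl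
  | 1, _ => rfl
  | j + 2, h => by
    have ih := antisymm_congr (j + 1) fun i hi => h i (by omega)
    simp only [antisymm, ih, h j (by omega)]

theorem map_kappa {B : Type*} [Ring B] [Algebra ℂ B] (φ : A →ₐ[ℂ] B) (σ : A) :
    φ (kappa q μ σ) = kappa q μ (φ σ) := by
  simp [kappa]

theorem map_baxterMinus {B : Type*} [Ring B] [Algebra ℂ B] (φ : A →ₐ[ℂ] B) (x : ℂ) (σ : A) :
    φ (baxterMinus q μ x σ) = baxterMinus q μ x (φ σ) := by
  simp [baxterMinus, map_kappa]

theorem map_antisymm {B : Type*} [Ring B] [Algebra ℂ B] (φ : A →ₐ[ℂ] B) (σ : ℕ → A) :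
    ∀ j : ℕ, φ (antisymm q μ σ j) = antisymm q μ (fun i => φ (σ i)) j
  | 0 => map_one φ
  | 1 => map_one φ
  | j + 2 => by
    simp only [antisymm, map_smul, map_mul, map_baxterMinus, map_antisymm φ σ (j + 1)]

/-- The factor q⁻¹ + σ of κ kills eigenvectors of eigenvalue -q⁻¹. -/
theorem kappa_mul_eq_zero {σ x : A} (h : σ * x = -q⁻¹ • x) : kappa q μ σ * x = 0 := by
  rw [kappa, smul_mul_assoc, mul_assoc, add_mul, h, smul_mul_assoc, one_mul]
  simp

theorem mul_kappa_eq_zero {σ x : A} (h : x * σ = -q⁻¹ • x) : x * kappa q μ σ = 0 := by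
  have : kappa q μ σ = (μ * (q - q⁻¹))⁻¹ • ((q⁻¹ • (1 : A) + σ) * (q • (1 : A) - σ)) := by
    unfold kappa
    congr 1
    simp only [sub_mul, mul_sub, add_mul, mul_add, smul_mul_assoc, mul_smul_comm, one_mul, mul_one]
    module
  rw [this, mul_smul_comm, ← mul_assoc, mul_add, h, mul_smul_comm, mul_one]
  simp

theorem add_smul_self (c : ℂ) (x : A) : x + c • x = (1 + c) • x := by
  rw [add_smul, one_smul]

/-- Where σ = -q⁻¹ and hence κ = 0, σ⁻(q^{-2i}) acts as (i+1)_q / q^i. The prefactor in the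
recursion for a^{(i+1)} is the inverse of this number. -/
theorem Generic.scalar_identity {k : ℕ} (g : Generic q μ k) {i : ℕ} (hi : i + 1 ≤ k) :
    (q ^ i / qNum q (i + 1)) * (1 + ((q ^ (2 * i))⁻¹ - 1) / (q - q⁻¹) * -q⁻¹) = 1 := by
  have h1 := g.qNum_ne (i := i + 1) (by omega) hi
  rw [div_mul_eq_mul_div, div_eq_one_iff_eq h1, qNum]
  have h2 := g.sub_inv_ne
  have h0 := g.q_ne
  have h4 : q ^ 2 - 1 ≠ 0 := fun h => h2 (by field_simp; rw [h, mul_zero])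
  field_simp
  rw [mul_comm 2 i, pow_mul]
  field_simp
  ring

theorem Generic.baxterMinus_mul {k : ℕ} (g : Generic q μ k) {i : ℕ} (hi : i + 1 ≤ k) {σ x : A}
    (h : σ * x = -q⁻¹ • x) :
    (q ^ i / qNum q (i + 1)) • (baxterMinus q μ ((q ^ (2 * i))⁻¹) σ * x) = x := by
  rw [baxterMinus, add_mul, add_mul, smul_mul_assoc, smul_mul_assoc, kappa_mul_eq_zero h, h,
    smul_zero, add_zero, one_mul, smul_smul, add_smul_self, smul_smul, g.scalar_identity hi,
    one_smul]

theorem Generic.mul_baxterMinus {k : ℕ} (g : Generic q μ k) {i : ℕ} (hi : i + 1 ≤ k) {σ x : A}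
    (h : x * σ = -q⁻¹ • x) :
    (q ^ i / qNum q (i + 1)) • (x * baxterMinus q μ ((q ^ (2 * i))⁻¹) σ) = x := by
  rw [baxterMinus, mul_add, mul_add, mul_smul_comm, mul_smul_comm, mul_kappa_eq_zero h, h,
    smul_zero, add_zero, mul_one, smul_smul, add_smul_self, smul_smul, g.scalar_identity hi,
    one_smul]

/-- Each normalized Baxterized factor acts as 1 on a common eigenvector of eigenvalue -q⁻¹. Together
with `sigma_antisymm` this yields both idempotence and the absorption of shorter antisymmetrizers.
-/
theorem Generic.antisymm_mul {k : ℕ} (g : Generic q μ k) {σ : ℕ → A} {x : A} :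
    ∀ j : ℕ, j ≤ k → (∀ i, i + 1 < j → σ i * x = -q⁻¹ • x) → antisymm q μ σ j * x = x
  | 0, _, _ => one_mul x
  | 1, _, _ => one_mul x
  | j + 2, hj, h => by
    have ih := g.antisymm_mul (j + 1) (by omega) fun i hi => h i (by omega)
    rw [antisymm, smul_mul_assoc, mul_assoc, ih, mul_assoc, ← mul_smul_comm,
      g.baxterMinus_mul hj (h j (by omega)), ih]

theorem Generic.mul_antisymm {k : ℕ} (g : Generic q μ k) {σ : ℕ → A} {x : A} :
    ∀ j : ℕ, j ≤ k → (∀ i, i + 1 < j → x * σ i = -q⁻¹ • x) → x * antisymm q μ σ j = x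
  | 0, _, _ => mul_one x
  | 1, _, _ => mul_one x
  | j + 2, hj, h => by
    have ih := g.mul_antisymm (j + 1) (by omega) fun i hi => h i (by omega)
    rw [antisymm, mul_smul_comm, ← mul_assoc, ← mul_assoc, ih, ← smul_mul_assoc,
      g.mul_baxterMinus hj (h j (by omega)), ih]

section
variable {n k : ℕ} {σ τ : ℕ → A}

/-- At x = q⁻² the coefficients of σ⁻(x) are such that it vanishes on the eigenvalues q and μ of σ,
leaving a multiple of the projector to -q⁻¹. -/
theorem Generic.sigma_mul_baxterMinus (g : Generic q μ k) (h : BMWRelations q μ n σ τ) {i : ℕ}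
    (hi : i + 1 < n) :
    σ i * baxterMinus q μ ((q ^ 2)⁻¹) (σ i) = -q⁻¹ • baxterMinus q μ ((q ^ 2)⁻¹) (σ i) := by
  have h0 := g.q_ne
  have h1 := g.denom_ne 1 le_rfl (by have := g.two_le; omega)
  have h2 := g.sub_inv_ne
  have h4 : q ^ 2 - 1 ≠ 0 := fun h => h2 (by field_simp; rw [h, mul_zero])
  rw [mul_one] at h1
  generalize hd : μ + q * (q ^ 2)⁻¹ = d at *
  have hd' : d * q = μ * q + 1 := by rw [← hd]; field_simp
  simp only [baxterMinus, hd, mul_add, mul_smul_comm, mul_one, sigma_sq h2 g.mu_ne,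
    h.sigma_kappa i hi]
  match_scalars
  · field_simp; ring
  · field_simp; ring
  · field_simp; linear_combination (q ^ 2 - 1) * μ * hd'

theorem Generic.baxterMinus_mul_sigma (g : Generic q μ k) (h : BMWRelations q μ n σ τ) {i : ℕ}
    (hi : i + 1 < n) :
    baxterMinus q μ ((q ^ 2)⁻¹) (σ i) * σ i = -q⁻¹ • baxterMinus q μ ((q ^ 2)⁻¹) (σ i) := by
  rw [← g.sigma_mul_baxterMinus h hi]
  exact (baxterMinus_commute _ (Commute.refl (σ i))).symm.eq

theorem BMWRelations.shift (h : BMWRelations q μ (n + 1) σ τ) :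
    BMWRelations q μ n (fun i => σ (i + 1)) (fun i => τ (i + 1)) where
  mul_inv i hi := h.mul_inv (i + 1) (by omega)
  inv_mul i hi := h.inv_mul (i + 1) (by omega)
  braid i hi := h.braid (i + 1) (by omega)
  comm i j hi hj := h.comm (i + 1) (j + 1) (by omega) (by omega)
  sigma_kappa i hi := h.sigma_kappa (i + 1) (by omega)
  kappa_sigma i hi := h.kappa_sigma (i + 1) (by omega)
  kappa_adj i j hi hj hij := h.kappa_adj (i + 1) (j + 1) (by omega) (by omega) (by omega)
  kappa_adj_inv i j hi hj hij := h.kappa_adj_inv (i + 1) (j + 1) (by omega) (by omega) (by omega)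
  adj_kappa i j hi hj hij := h.adj_kappa (i + 1) (j + 1) (by omega) (by omega) (by omega)
  adj_inv_kappa i j hi hj hij := h.adj_inv_kappa (i + 1) (j + 1) (by omega) (by omega) (by omega)
  kappa_kappa_kappa i j hi hj hij :=
    h.kappa_kappa_kappa (i + 1) (j + 1) (by omega) (by omega) (by omega)
  kappa_sq i hi := h.kappa_sq (i + 1) (by omega)

theorem BMWRelations.of_le {m : ℕ} (h : BMWRelations q μ n σ τ) (hm : m ≤ n) :
    BMWRelations q μ m σ τ where
  mul_inv i hi := h.mul_inv i (by omega)
  inv_mul i hi := h.inv_mul i (by omega)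
  braid i hi := h.braid i (by omega)
  comm i j hi hj := h.comm i j (by omega) (by omega)
  sigma_kappa i hi := h.sigma_kappa i (by omega)
  kappa_sigma i hi := h.kappa_sigma i (by omega)
  kappa_adj i j hi hj := h.kappa_adj i j (by omega) (by omega)
  kappa_adj_inv i j hi hj := h.kappa_adj_inv i j (by omega) (by omega)
  adj_kappa i j hi hj := h.adj_kappa i j (by omega) (by omega)
  adj_inv_kappa i j hi hj := h.adj_inv_kappa i j (by omega) (by omega)
  kappa_kappa_kappa i j hi hj := h.kappa_kappa_kappa i j (by omega) (by omega)
  kappa_sq i hi := h.kappa_sq i (by omega)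

theorem BMWRelations.reverse (h : BMWRelations q μ n σ τ) :
    BMWRelations q μ n (fun i => σ (n - 2 - i)) (fun i => τ (n - 2 - i)) where
  mul_inv i hi := h.mul_inv _ (by omega)
  inv_mul i hi := h.inv_mul _ (by omega)
  braid i hi := by
    have := h.braid (n - 2 - (i + 1)) (by omega)
    rw [show n - 2 - (i + 1) + 1 = n - 2 - i by omega] at this
    exact this.symm
  comm i j hi hj := (h.comm _ _ (by omega) (by omega)).symm
  sigma_kappa i hi := h.sigma_kappa _ (by omega)
  kappa_sigma i hi := h.kappa_sigma _ (by omega)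
  kappa_adj i j hi hj hij := h.kappa_adj _ _ (by omega) (by omega) (by omega)
  kappa_adj_inv i j hi hj hij := h.kappa_adj_inv _ _ (by omega) (by omega) (by omega)
  adj_kappa i j hi hj hij := h.adj_kappa _ _ (by omega) (by omega) (by omega)
  adj_inv_kappa i j hi hj hij := h.adj_inv_kappa _ _ (by omega) (by omega) (by omega)
  kappa_kappa_kappa i j hi hj hij := h.kappa_kappa_kappa _ _ (by omega) (by omega) (by omega)
  kappa_sq i hi := h.kappa_sq _ (by omega)

theorem BMWRelations.commute (h : BMWRelations q μ n σ τ) {i j : ℕ} (hij : i + 1 < j)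
    (hj : j + 1 < n) : Commute (σ j) (σ i) := (h.comm i j hij hj).symm

/-- Induction on j. All generators but the last are handled by the outer factors of the recursion.
For the last one, the Yang–Baxter equation moves a factor σ⁻(q⁻²) of that generator to the outside.
-/
theorem Generic.sigma_antisymm (g : Generic q μ k) (h : BMWRelations q μ n σ τ) :
    ∀ j : ℕ, j ≤ k → j ≤ n → ∀ i, i + 1 < j →
      σ i * antisymm q μ σ j = -q⁻¹ • antisymm q μ σ j ∧
      antisymm q μ σ j * σ i = -q⁻¹ • antisymm q μ σ j
  | 0, _, _, i, hi => by omega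
  | 1, _, _, i, hi => by omega
  | 2, _, hn, i, hi => by
    obtain rfl : i = 0 := by omega
    have h1 := g.sigma_mul_baxterMinus h (i := 0) (by omega)
    have h2 := g.baxterMinus_mul_sigma h (i := 0) (by omega)
    simp only [antisymm, one_mul, mul_one, zero_add, mul_smul_comm, smul_mul_assoc, h1, h2]
    exact ⟨smul_comm _ _ _, smul_comm _ _ _⟩
  | j + 3, hk, hn, i, hi => by
    have ih := g.sigma_antisymm h (j + 2) (by omega) (by omega)
    rcases Nat.lt_or_ge (i + 1) (j + 2) with hij | hij
    · rw [antisymm]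
      constructor
      · rw [mul_smul_comm, ← mul_assoc, ← mul_assoc, (ih i hij).1]
        simp only [smul_mul_assoc]
        exact smul_comm _ _ _
      · rw [smul_mul_assoc, mul_assoc, (ih i hij).2]
        simp only [mul_smul_comm]
        exact smul_comm _ _ _
    obtain rfl : i = j + 1 := by omega
    -- The spectral parameters multiply: q^{-2(j+1)} · q^{-2} = q^{-2(j+2)}. The two orders of x and
    -- y serve the left and right eigenvector statements.
    have hYB := h.baxter_yang_baxter g.sub_inv_ne g.mu_ne (i := j) (by omega)
      (x := (q ^ (2 * (j + 1)))⁻¹) (y := (q ^ (2 * 1))⁻¹) (z := (q ^ (2 * (j + 1 + 1)))⁻¹)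
      (by rw [← mul_inv, ← pow_add]; congr 2)
      (g.denom_ne _ (by omega) (by omega)) (g.denom_ne _ (by omega) (by omega))
      (g.denom_ne _ (by omega) (by omega))
    have hYB' := h.baxter_yang_baxter g.sub_inv_ne g.mu_ne (i := j) (by omega)
      (x := (q ^ (2 * 1))⁻¹) (y := (q ^ (2 * (j + 1)))⁻¹) (z := (q ^ (2 * (j + 1 + 1)))⁻¹)
      (by rw [← mul_inv, ← pow_add]; congr 2; omega)
      (g.denom_ne _ (by omega) (by omega)) (g.denom_ne _ (by omega) (by omega))
      (g.denom_ne _ (by omega) (by omega))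
    have hW := g.sigma_mul_baxterMinus h (i := j + 1) (by omega)
    have hW' := g.baxterMinus_mul_sigma h (i := j + 1) (by omega)
    have hb := g.baxterMinus_mul (i := 1) (by omega) (ih j (by omega)).1
    have hb' := g.mul_baxterMinus (i := 1) (by omega) (ih j (by omega)).2
    have hcb := g.antisymm_mul (j + 1) (by omega) fun i hi => (ih i (by omega)).1
    have hbc := g.mul_antisymm (j + 1) (by omega) fun i hi => (ih i (by omega)).2
    have hc : Commute (σ (j + 1)) (antisymm q μ σ (j + 1)) :=
      antisymm_commute _ fun i hi => h.commute (by omega) (by omega)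
    have hcX : ∀ y, Commute (antisymm q μ σ (j + 1)) (baxterMinus q μ y (σ (j + 1))) :=
      fun y => baxterMinus_commute _ hc.symm
    have hbd : antisymm q μ σ (j + 2) = (q ^ (j + 1) / qNum q (j + 2)) •
      (antisymm q μ σ (j + 1) * baxterMinus q μ ((q ^ (2 * (j + 1)))⁻¹) (σ j)
        * antisymm q μ σ (j + 1)) := rfl
    rw [antisymm]
    rw [mul_one] at hb hb' hYB hYB'
    generalize antisymm q μ σ (j + 2) = b at *
    generalize antisymm q μ σ (j + 1) = c at *
    generalize q ^ 1 / qNum q (1 + 1) = w at *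
    generalize q ^ (j + 1) / qNum q (j + 2) = α at *
    generalize q ^ (j + 1 + 1) / qNum q (j + 1 + 2) = β at *
    generalize baxterMinus q μ ((q ^ (2 * (j + 1)))⁻¹) (σ j) = Y at *
    constructor
    · suffices hs : ∃ z, b * baxterMinus q μ ((q ^ (2 * (j + 1 + 1)))⁻¹) (σ (j + 1)) * b =
          baxterMinus q μ ((q ^ 2)⁻¹) (σ (j + 1)) * z by
        obtain ⟨z, hz⟩ := hs
        rw [hz, mul_smul_comm, ← mul_assoc, hW, smul_mul_assoc, smul_comm]
      -- Expand the left b as α c Y c. The inner c commutes with the middle factor and is absorbed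
      -- by the right b, which in turn yields a factor w σ_j⁻(q⁻²). The Yang–Baxter equation then
      -- applies, and σ_{j+1}⁻(q⁻²) passes the remaining c.
      refine ⟨α • w • (c * baxterMinus q μ ((q ^ (2 * (j + 1 + 1)))⁻¹) (σ j) *
        baxterMinus q μ ((q ^ (2 * (j + 1)))⁻¹) (σ (j + 1)) * b), ?_⟩
      nth_rw 1 [hbd]
      rw [smul_mul_assoc, smul_mul_assoc, mul_assoc, mul_assoc (c * Y), ← mul_assoc c,
        (hcX _).eq, mul_assoc _ c b, hcb, mul_assoc c]
      nth_rw 1 [← hb]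
      simp only [mul_smul_comm]
      rw [← mul_assoc _ _ b, ← mul_assoc Y, ← mul_assoc Y, hYB]
      simp only [mul_assoc]
      rw [← mul_assoc c, (hcX _).eq]
      simp only [mul_assoc]
    · suffices hs : ∃ z, b * baxterMinus q μ ((q ^ (2 * (j + 1 + 1)))⁻¹) (σ (j + 1)) * b =
          z * baxterMinus q μ ((q ^ 2)⁻¹) (σ (j + 1)) by
        obtain ⟨z, hz⟩ := hs
        rw [hz, smul_mul_assoc, mul_assoc, hW', mul_smul_comm, smul_comm]
      refine ⟨α • w • (b * baxterMinus q μ ((q ^ (2 * (j + 1)))⁻¹) (σ (j + 1)) *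
        baxterMinus q μ ((q ^ (2 * (j + 1 + 1)))⁻¹) (σ j) * c), ?_⟩
      nth_rw 2 [hbd]
      rw [mul_smul_comm, mul_assoc c, ← mul_assoc _ c, mul_assoc b, ← (hcX _).eq, ← mul_assoc b,
        hbc, ← mul_assoc _ Y c]
      nth_rw 1 [← hb']
      simp only [smul_mul_assoc]
      rw [mul_assoc b, mul_assoc b, hYB']
      simp only [mul_assoc]
      rw [(hcX _).eq]

theorem Generic.antisymm_idem (g : Generic q μ k) (h : BMWRelations q μ n σ τ) {j : ℕ}
    (hk : j ≤ k) (hn : j ≤ n) : antisymm q μ σ j * antisymm q μ σ j = antisymm q μ σ j :=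
  g.antisymm_mul j hk fun i hi => (g.sigma_antisymm h j hk hn i hi).1

/-- Both elements are two-sided eigenvectors of the same generators, so each acts as 1 on the other
and their product equals either of them. -/
theorem Generic.antisymm_reverse (g : Generic q μ k) {j : ℕ} (h : BMWRelations q μ j σ τ)
    (hk : j ≤ k) : antisymm q μ (fun i => σ (j - 2 - i)) j = antisymm q μ σ j := by
  rw [← g.antisymm_mul (σ := σ) (x := antisymm q μ (fun i => σ (j - 2 - i)) j) j hk fun i hi => ?_]
  · refine g.mul_antisymm j hk fun i hi => (g.sigma_antisymm h j hk le_rfl _ (by omega)).2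
  · have := (g.sigma_antisymm h.reverse j hk le_rfl (j - 2 - i) (by omega)).1
    simpa only [show j - 2 - (j - 2 - i) = i by omega] using this

/-- The recursion for `a^{(j+1)}` that adds a leg on the left. -/
theorem Generic.antisymm_succ_left (g : Generic q μ k) {j : ℕ}
    (h : BMWRelations q μ (j + 2) σ τ) (hk : j + 2 ≤ k) :
    antisymm q μ σ (j + 2) = (q ^ (j + 1) / qNum q (j + 2)) •
      (antisymm q μ (fun i => σ (i + 1)) (j + 1) *
        baxterMinus q μ ((q ^ (2 * (j + 1)))⁻¹) (σ 0) *
        antisymm q μ (fun i => σ (i + 1)) (j + 1)) := by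
  rw [← g.antisymm_reverse h hk, antisymm]
  have : antisymm q μ (fun i => σ (j + 2 - 2 - i)) (j + 1) =
      antisymm q μ (fun i => σ (i + 1)) (j + 1) := by
    rw [← g.antisymm_reverse (σ := fun i => σ (i + 1)) h.shift (by omega)]
    refine antisymm_congr _ fun i hi => ?_
    congr 1; omega
  rw [this]
  simp

theorem mul_conj_mul_of_commute {S : Type*} [Semigroup S] {c κ : S} (hc : Commute c κ) (B : S) :
    κ * (c * B * c) * κ = c * (κ * B * κ) * c := by
  calc κ * (c * B * c) * κ = (κ * c) * B * (c * κ) := by simp only [mul_assoc]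
    _ = (c * κ) * B * (κ * c) := by rw [hc.eq]
    _ = c * (κ * B * κ) * c := by simp only [mul_assoc]

/-- The scalar in `κ a κ = δ a' κ`, where `a = a^{(j+1)}` and `a'` is its restriction to the
complement of the closed leg. -/
noncomputable def closingFactor (q μ : ℂ) (j : ℕ) : ℂ :=
  (q ^ j / qNum q (j + 1)) * (eta q μ + ((q ^ (2 * j))⁻¹ - 1) / (q - q⁻¹) * μ⁻¹ +
    μ * ((q ^ (2 * j))⁻¹ - 1) / (μ + q * (q ^ (2 * j))⁻¹))

/-- The three terms of the scalar come from κ_i² = ηκ_i, κ_iσ_jκ_i = μ⁻¹κ_i and κ_iκ_jκ_i = κ_i. -/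
theorem Generic.kappa_baxterMinus_kappa (g : Generic q μ k) (h : BMWRelations q μ n σ τ)
    {i j : ℕ} (hi : i + 1 < n) (hj : j + 1 < n) (hij : j = i + 1 ∨ i = j + 1) (x : ℂ) :
    kappa q μ (σ i) * baxterMinus q μ x (σ j) * kappa q μ (σ i) =
      (eta q μ + (x - 1) / (q - q⁻¹) * μ⁻¹ + μ * (x - 1) / (μ + q * x)) • kappa q μ (σ i) := by
  simp only [baxterMinus, mul_add, add_mul, mul_smul_comm, smul_mul_assoc, mul_one,
    h.kappa_sq i hi, h.kappa_kappa_kappa i j hi hj hij, mul_assoc]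
  rw [h.kappa_sigma_kappa g.mu_ne hi hj hij]
  module

/-- κ on the last leg and one further leg commutes with the outer a^{(j+1)} of the recursion, so
only the Baxterized middle factor is closed. The version for the first leg uses the left recursion
in the same way. -/
theorem Generic.kappa_antisymm_kappa_last (g : Generic q μ k) {j : ℕ}
    (h : BMWRelations q μ n σ τ) (hk : j + 2 ≤ k) (hn : j + 3 ≤ n) :
    kappa q μ (σ (j + 1)) * antisymm q μ σ (j + 2) * kappa q μ (σ (j + 1)) =
      closingFactor q μ (j + 1) • (antisymm q μ σ (j + 1) * kappa q μ (σ (j + 1))) := by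
  have hc : Commute (antisymm q μ σ (j + 1)) (kappa q μ (σ (j + 1))) :=
    kappa_commute (antisymm_commute _ fun i hi => h.commute (by omega) (by omega)).symm
  have hid := g.antisymm_idem h (j := j + 1) (by omega) (by omega)
  have hb := g.kappa_baxterMinus_kappa h (i := j + 1) (j := j) (by omega) (by omega)
    (Or.inr rfl) ((q ^ (2 * (j + 1)))⁻¹)
  rw [antisymm, closingFactor, mul_smul_comm, smul_mul_assoc, mul_smul]
  congr 1
  refine (mul_conj_mul_of_commute hc _).trans ?_
  rw [hb, mul_smul_comm, smul_mul_assoc, mul_assoc, ← hc.eq, ← mul_assoc, hid]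

theorem Generic.kappa_antisymm_kappa_first (g : Generic q μ k) {j : ℕ}
    (h : BMWRelations q μ n σ τ) (hk : j + 2 ≤ k) (hn : j + 3 ≤ n) :
    kappa q μ (σ 0) * antisymm q μ (fun i => σ (i + 1)) (j + 2) * kappa q μ (σ 0) =
      closingFactor q μ (j + 1) •
        (antisymm q μ (fun i => σ (i + 1 + 1)) (j + 1) * kappa q μ (σ 0)) := by
  have h1 := (h.of_le hn).shift
  have h2 := h1.shift
  have hc : Commute (antisymm q μ (fun i => σ (i + 1 + 1)) (j + 1)) (kappa q μ (σ 0)) :=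
    kappa_commute (antisymm_commute _ fun i hi => h.comm _ _ (by omega) (by omega)).symm
  have hid := g.antisymm_idem h2 (j := j + 1) (by omega) (by omega)
  have hb := g.kappa_baxterMinus_kappa h (i := 0) (j := 0 + 1) (by omega) (by omega)
    (Or.inl rfl) ((q ^ (2 * (j + 1)))⁻¹)
  rw [g.antisymm_succ_left h1 hk, closingFactor, mul_smul_comm, smul_mul_assoc, mul_smul]
  congr 1
  refine (mul_conj_mul_of_commute hc _).trans ?_
  rw [hb, mul_smul_comm, smul_mul_assoc, mul_assoc, ← hc.eq, ← mul_assoc, hid]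
end

end BMW

/-! ### Scalar identities at μ = q^{1-k} -/

section Scalars
variable {q μ : ℂ} {k : ℕ}

theorem HasHeight.generic {N : ℕ} {R : (TensorOp N 2 ℂ)ˣ} (h : HasHeight q μ k R) :
    Generic q μ k where
  two_le := h.two_le
  q_ne := h.bmw.q_ne.1
  mu_ne := h.bmw.mu_ne.1
  pow_ne := h.q_pow_ne
  denom_ne i h1 hi h0 := by
    refine h.mu_ne i h1 hi ?_
    rw [zpow_sub₀ h.bmw.q_ne.1, zpow_one, eq_neg_iff_add_eq_zero, ← h0, div_eq_mul_inv]
    norm_cast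

/-- The numerator factors as (q² - μ²q^{2j})(μ + q^{-1-2j}). The second factor is nonzero by
genericity, the first by the extra hypothesis. -/
theorem Generic.closingFactor_ne_zero (g : Generic q μ k) {j : ℕ} (hj : 1 ≤ j) (hjk : j + 1 ≤ k)
    (hμ : μ ^ 2 * q ^ (2 * j) ≠ q ^ 2) : closingFactor q μ j ≠ 0 := by
  have h0 := g.q_ne
  have hm := g.mu_ne
  have hl := g.sub_inv_ne
  have h4 : q ^ 2 - 1 ≠ 0 := fun h => hl (by field_simp; rw [h, mul_zero])
  have hp : q ^ (2 * j) ≠ 0 := pow_ne_zero _ h0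
  have hd := g.denom_ne j hj (by omega)
  have hd' := g.denom_ne (j + 1) (by omega) hjk
  refine mul_ne_zero (div_ne_zero (pow_ne_zero _ h0) (g.qNum_ne (by omega) hjk)) ?_
  rw [mul_add 2 j, pow_add] at hd'
  generalize q ^ (2 * j) = p at *
  obtain ⟨r, rfl⟩ : ∃ r, p = r⁻¹ := ⟨p⁻¹, (inv_inv p).symm⟩
  rw [inv_inv] at *
  have hr : r ≠ 0 := by rintro rfl; simp at hp
  have key : eta q μ + (r - 1) / (q - q⁻¹) * μ⁻¹ + μ * (r - 1) / (μ + q * r) =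
      (q ^ 2 - μ ^ 2 * r⁻¹) * (μ + q * (r⁻¹ * q ^ (2 * 1))⁻¹) /
        (r⁻¹ * (q - q⁻¹) * μ * (μ + q * r)) := by
    generalize hx : μ + q * r = d at *
    unfold eta
    field_simp
    subst hx
    ring
  rw [key]
  exact div_ne_zero (mul_ne_zero (sub_ne_zero.mpr hμ.symm) hd')
    (mul_ne_zero (mul_ne_zero (mul_ne_zero hp hl) hm) hd)

/-- For μ = q^{1-k} equality would mean q^{2(k-j)} = 1. -/
theorem muO_sq_mul_pow_ne (g : Generic q (muO q k) k) {j : ℕ} (hjk : j + 1 ≤ k) :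
    muO q k ^ 2 * q ^ (2 * j) ≠ q ^ 2 := by
  intro h
  refine g.pow_ne (k - j) (by omega) (by omega) ?_
  have h0 := g.q_ne
  obtain ⟨m, rfl⟩ := Nat.exists_eq_add_of_le (show j ≤ k by omega)
  rw [muO, zpow_sub₀ h0, zpow_one, zpow_natCast] at h
  rw [Nat.add_sub_cancel_left]
  field_simp at h
  refine mul_left_cancel₀ (pow_ne_zero (2 * j) h0) ?_
  rw [← pow_add, ← mul_add, mul_one, pow_mul', h]

/-- The origin of the normalization of O. Here s is the scalar of a'σ₁a' = s a', the hypothesis is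
the height condition at q^{-2(k+1)}, and the conclusion says that the scalar of a' a a' is the
inverse square of `oFactor`. -/
theorem middle_factor (g : Generic q (muO q (k + 1)) (k + 1)) (hμ : muO q (k + 1) ≠ -q⁻¹) {s : ℂ}
    (hs : 1 + ((q ^ (2 * (k + 1)))⁻¹ - 1) / (q - q⁻¹) * s +
      muO q (k + 1) * ((q ^ (2 * (k + 1)))⁻¹ - 1) / (muO q (k + 1) + q * (q ^ (2 * (k + 1)))⁻¹) *
        closingFactor q (muO q (k + 1)) k = 0) :
    (q ^ k / qNum q (k + 1)) * (1 + ((q ^ (2 * k))⁻¹ - 1) / (q - q⁻¹) * s +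
      muO q (k + 1) * ((q ^ (2 * k))⁻¹ - 1) / (muO q (k + 1) + q * (q ^ (2 * k))⁻¹) *
        closingFactor q (muO q (k + 1)) k) * (oFactor q (k + 1) * oFactor q (k + 1)) = 1 := by
  have h0 := g.q_ne
  have hl := g.sub_inv_ne
  have h2 := g.two_le
  have h4 : q ^ 2 - 1 ≠ 0 := fun h => hl (by field_simp; rw [h, mul_zero])
  have hd := g.denom_ne k (by omega) (by omega)
  have hd' := g.denom_ne (k + 1) (by omega) (by omega)
  have hp := g.pow_ne (k + 1) (by omega) le_rfl
  have hQ : qNum q (k + 1) = (q * q ^ k - (q * q ^ k)⁻¹) / (q - q⁻¹) := by rw [qNum, pow_succ']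
  have hM : muO q (k + 1) = (q ^ k)⁻¹ := by
    rw [muO, ← zpow_natCast, ← _root_.zpow_neg]; congr 1; push_cast; ring
  have hO : oFactor q (k + 1) = qNum q (k + 1) * (1 + q * (q ^ k)⁻¹) / (q + (q ^ k)⁻¹) := by
    have h1 : q ^ (1 - ((k + 1 : ℕ) : ℤ)) = (q ^ k)⁻¹ := hM
    have h2 : q ^ (2 - ((k + 1 : ℕ) : ℤ)) = q * (q ^ k)⁻¹ := by
      rw [← h1, ← zpow_one_add₀ h0]; congr 1; push_cast; ring
    rw [oFactor, h1, h2]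
  rw [hO]
  unfold closingFactor eta at *
  rw [hM] at hμ hd hd' hs ⊢
  rw [hQ] at hs ⊢
  rw [show q ^ (2 * (k + 1)) = q ^ 2 * (q ^ k) ^ 2 by ring] at *
  rw [show q ^ (2 * k) = (q ^ k) ^ 2 by ring] at *
  have hp0 : q ^ k ≠ 0 := pow_ne_zero _ h0
  generalize q ^ k = p at *
  -- With r = q^{-k} = μ everything becomes rational in q and r.
  obtain ⟨r, rfl⟩ : ∃ r, p = r⁻¹ := ⟨p⁻¹, (inv_inv p).symm⟩
  simp only [inv_inv, mul_inv, inv_pow] at *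
  have hr : r ≠ 0 := by rintro rfl; simp at hp0
  have e1 : 1 + q * r ≠ 0 := fun h => hμ (by field_simp; linear_combination h)
  have e2 : q + r ≠ 0 := fun h => hd' (by field_simp; rw [h]; simp)
  have e3 : q ^ 2 - r ^ 2 ≠ 0 := fun h => hp (by field_simp; linear_combination h)
  have e4 : r + q * r ^ 2 = r * (1 + q * r) := by ring
  have e5 : r + q * ((q ^ 2)⁻¹ * r ^ 2) = r * (q + r) / q := by field_simp
  have e6 : (q ^ 2)⁻¹ * r ^ 2 - 1 = -(q ^ 2 - r ^ 2) / q ^ 2 := by field_simp; ring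
  have e7 : q * r⁻¹ - q⁻¹ * r = (q ^ 2 - r ^ 2) / (q * r) := by field_simp
  have e8 : q - q⁻¹ = (q ^ 2 - 1) / q := by field_simp
  rw [e4, e5, e6, e7, e8] at hs
  rw [e4, e7, e8]
  have eX : (q - r) * (q⁻¹ + r) / (r * ((q ^ 2 - 1) / q)) + (r ^ 2 - 1) / ((q ^ 2 - 1) / q) * r⁻¹ +
      r * (r ^ 2 - 1) / (r * (1 + q * r)) = r * (q + r) / (1 + q * r) := by
    field_simp
    ring
  rw [eX] at hs ⊢
  -- The height condition is linear in s; this is its solution.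
  have es : s = (q ^ 2 - 1) * (q + r) / ((q ^ 2 - r ^ 2) * (1 + q * r)) := by
    clear hO eX e4 e5 e6 e7 e8 hQ hd hd'
    generalize hE2 : q + r = E2 at *
    generalize hE3 : q ^ 2 - r ^ 2 = E3 at *
    generalize hE1 : 1 + q * r = E1 at *
    generalize hE4 : q ^ 2 - 1 = E4 at *
    have h5 : q * E1 - r * E4 = E2 := by rw [← hE1, ← hE2, ← hE4]; ring
    field_simp at hs ⊢
    linear_combination E4 * h5 - hs
  rw [es]
  generalize hE3 : q ^ 2 - r ^ 2 = E3 at *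
  generalize hE1 : 1 + q * r = E1 at *
  have e9 : q + r ≠ 0 := e2
  field_simp
  subst hE1 hE3
  ring
end Scalars

/-! ### Calculus of operators acting on consecutive legs -/

section Legs
variable {N p r n : ℕ} {A : Type*}

/-- Splitting a multi-index into its values on the legs `s, …, s + p - 1` and on the others. -/
def legsEquiv (N : ℕ) {p n s : ℕ} (h : s + p ≤ n) :
    (Fin n → Fin N) ≃ (Fin p → Fin N) × ({j : Fin n // j.1 < s ∨ s + p ≤ j.1} → Fin N) where
  toFun a := (fun t => a ⟨s + t.1, by omega⟩, fun j => a j.1)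
  invFun x j := if hj : j.1 < s ∨ s + p ≤ j.1 then x.2 ⟨j, hj⟩ else x.1 ⟨j.1 - s, by omega⟩
  left_inv a := by
    funext j
    by_cases hj : j.1 < s ∨ s + p ≤ j.1
    · simp [hj]
    · simp only [hj, dite_false]
      congr 1
      ext
      simp only
      omega
  right_inv x := by
    refine Prod.ext (funext fun t => ?_) (funext fun j => ?_)
    · simp
    · simp [j.2]

/-- After regrouping indices, X on some legs is block diagonal with all blocks X, so products and
units are inherited from block diagonal matrices. -/
theorem legs_eq_submatrix [Zero A] (X : TensorOp N p A) {s : ℕ} (h : s + p ≤ n) :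
    legs X n s = (blockDiagonal fun _ => X).submatrix (legsEquiv N h) (legsEquiv N h) := by
  ext a b
  simp only [legs, h, dite_true, submatrix_apply, blockDiagonal_apply, legsEquiv, Equiv.coe_fn_mk]
  congr 1
  simp [funext_iff]

theorem legs_mul [NonUnitalNonAssocSemiring A] (X Y : TensorOp N p A) {s : ℕ} (h : s + p ≤ n) :
    legs (X * Y) n s = legs X n s * legs Y n s := by
  simp only [legs_eq_submatrix _ h]
  rw [submatrix_mul_equiv, ← blockDiagonal_mul]

theorem legs_one [Semiring A] {s : ℕ} (h : s + p ≤ n) :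
    legs (1 : TensorOp N p A) n s = 1 := by
  rw [legs_eq_submatrix _ h]
  exact (congrArg (fun X => submatrix X _ _) blockDiagonal_one).trans (submatrix_one_equiv _)

theorem legs_zero [Zero A] (s : ℕ) : legs (0 : TensorOp N p A) n s = 0 := by
  ext a b
  simp [legs]

/-- `legs` as a homomorphism of algebras. -/
def legsHom (N : ℕ) (A : Type*) [Semiring A] [Algebra ℂ A] {p n s : ℕ} (h : s + p ≤ n) :
    TensorOp N p A →ₐ[ℂ] TensorOp N n A where
  toFun X := legs X n s
  map_one' := legs_one h
  map_mul' X Y := legs_mul X Y h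
  map_zero' := legs_zero s
  map_add' X Y := by
    ext a b
    simp only [legs, h, dite_true, Matrix.add_apply]
    split_ifs <;> simp
  commutes' c := by
    rw [Algebra.algebraMap_eq_smul_one, Algebra.algebraMap_eq_smul_one, ← legs_one h]
    ext a b
    simp only [legs, h, dite_true, Matrix.smul_apply]
    split_ifs <;> simp

theorem legsHom_apply [Semiring A] [Algebra ℂ A] {s : ℕ} (h : s + p ≤ n) (X : TensorOp N p A) :
    legsHom N A h X = legs X n s := rfl

theorem legs_legs [Zero A] (X : TensorOp N p A) {m s t : ℕ} (h : s + p ≤ m) (h' : t + m ≤ n) :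
    legs (legs X m s) n t = legs X n (t + s) := by
  ext a b
  simp only [legs, h, h', show t + s + p ≤ n by omega, dite_true, ← add_assoc]
  rw [← ite_and]
  refine if_congr ⟨fun hh j hj => ?_, fun hh => ⟨fun j hj => hh j (by omega), fun j hj =>
    hh _ (by simp only; omega)⟩⟩ rfl rfl
  by_cases hj' : j.1 < t ∨ t + m ≤ j.1
  · exact hh.1 j hj'
  · have := hh.2 ⟨j.1 - t, by omega⟩ (by simp only; omega)
    simpa only [show t + (j.1 - t) = j.1 by omega] using this

theorem legs_map {B : Type*} [Zero A] [Zero B] (f : A → B) (hf : f 0 = 0) (X : TensorOp N p A)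
    (s : ℕ) : (legs X n s).map f = legs (X.map f) n s := by
  ext a b
  simp only [legs, map_apply]
  split_ifs <;> simp [hf]

theorem legs_mul_legs_apply [NonUnitalNonAssocSemiring A] (X : TensorOp N p A)
    (Y : TensorOp N r A) {s t : ℕ} (hs : s + p ≤ n) (ht : t + r ≤ n)
    (hd : s + p ≤ t ∨ t + r ≤ s) (a b : Fin n → Fin N) :
    (legs X n s * legs Y n t) a b =
      if ∀ j : Fin n, (j.1 < s ∨ s + p ≤ j.1) → (j.1 < t ∨ t + r ≤ j.1) → a j = b j then
        X (fun i => a ⟨s + i.1, by omega⟩) (fun i => b ⟨s + i.1, by omega⟩) *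
          Y (fun i => a ⟨t + i.1, by omega⟩) (fun i => b ⟨t + i.1, by omega⟩)
      else 0 := by
  rw [mul_apply]
  -- The only intermediate index that can contribute: off the legs of X it must agree with a, and on
  -- them with b since Y is the identity there.
  let c₀ : Fin n → Fin N := fun j => if j.1 < s ∨ s + p ≤ j.1 then a j else b j
  rw [Finset.sum_eq_single c₀]
  · simp only [legs, hs, ht, dite_true]
    rw [if_pos (fun j hj => by simp [c₀, hj])]
    have e1 : (fun i : Fin p => c₀ ⟨s + i.1, by omega⟩) = fun i => b ⟨s + i.1, by omega⟩ := by
      funext i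
      simp only [c₀]
      rw [if_neg (by omega)]
    have e2 : (fun i : Fin r => c₀ ⟨t + i.1, by omega⟩) = fun i => a ⟨t + i.1, by omega⟩ := by
      funext i
      simp only [c₀]
      rw [if_pos (by omega)]
    rw [e1, e2, mul_ite, mul_zero]
    refine if_congr ⟨fun h j h1 h2 => ?_, fun h j h2 => ?_⟩ rfl rfl
    · have := h j h2
      simpa only [c₀, h1, if_true] using this
    · by_cases h1 : j.1 < s ∨ s + p ≤ j.1
      · simpa only [c₀, h1, if_true] using h j h1 h2
      · simp only [c₀, h1, if_false]
  · intro c _ hc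
    simp only [legs, hs, ht, dite_true]
    by_cases h1 : ∀ j : Fin n, (j.1 < s ∨ s + p ≤ j.1) → a j = c j
    · by_cases h2 : ∀ j : Fin n, (j.1 < t ∨ t + r ≤ j.1) → c j = b j
      · refine absurd (funext fun j => ?_) hc
        by_cases h3 : j.1 < s ∨ s + p ≤ j.1
        · simp only [c₀, h3, if_true, h1 j h3]
        · simp only [c₀, h3, if_false]
          exact h2 j (by omega)
      · rw [if_neg h2, mul_zero]
    · rw [if_neg h1, zero_mul]
  · intro h; exact absurd (Finset.mem_univ _) h

theorem legs_commute [NonUnitalNonAssocSemiring A] (X : TensorOp N p A) (Y : TensorOp N r A)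
    (hXY : ∀ a b c d, Commute (X a b) (Y c d)) {s t : ℕ} (hs : s + p ≤ n) (ht : t + r ≤ n)
    (hd : s + p ≤ t ∨ t + r ≤ s) : Commute (legs X n s) (legs Y n t) := by
  ext a b
  rw [legs_mul_legs_apply X Y hs ht hd, legs_mul_legs_apply Y X ht hs hd.symm]
  refine if_congr ⟨fun h j h1 h2 => h j h2 h1, fun h j h1 h2 => h j h2 h1⟩ ?_ rfl
  exact hXY _ _ _ _

/-- A factor of a tensor product of operators that vanishes is zero if the other one is not. -/
theorem eq_zero_of_legs_mul_legs [NonUnitalNonAssocSemiring A] [NoZeroDivisors A]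
    {X : TensorOp N p A} {Y : TensorOp N r A} (hY : Y ≠ 0)
    (h : legs X (p + r) 0 * legs Y (p + r) p = 0) : X = 0 := by
  by_contra hX
  apply hY
  obtain ⟨a, b, hab⟩ : ∃ a b, X a b ≠ 0 := by
    by_contra! hh
    exact hX (ext hh)
  ext c d
  have h1 := congrFun (congrFun h (Fin.append a c)) (Fin.append b d)
  rw [legs_mul_legs_apply X Y (by omega) (by omega) (Or.inl (by omega)),
    if_pos (fun j h1 h2 => by omega)] at h1
  have ea : ∀ (a : Fin p → Fin N) (c : Fin r → Fin N),
      (fun i : Fin p => Fin.append a c ⟨0 + i.1, by omega⟩) = a := fun a c => by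
    funext i
    have : (⟨0 + i.1, by omega⟩ : Fin (p + r)) = Fin.castAdd r i := by ext; simp
    rw [this, Fin.append_left]
  have ec : ∀ (a : Fin p → Fin N) (c : Fin r → Fin N),
      (fun i : Fin r => Fin.append a c ⟨p + i.1, by omega⟩) = c := fun a c => by
    funext i
    exact Fin.append_right a c i
  rw [ea, ea, ec, ec] at h1
  exact (mul_eq_zero.mp h1).resolve_left hab

end Legs

/-! ### Numerical matrices and scalars of the coefficient algebra -/

section Numeric
variable {l m o : Type*} {A : Type*} [Ring A] [Algebra ℂ A]

/-- A rectangular numerical matrix viewed as a matrix with entries in `A`. -/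
def numeric (A : Type*) [Ring A] [Algebra ℂ A] (X : Matrix l m ℂ) : Matrix l m A :=
  X.map (algebraMap ℂ A)

theorem coeffs_eq_numeric (X : Matrix l l ℂ) : coeffs A X = numeric A X := rfl

theorem numeric_mul [Fintype m] (X : Matrix l m ℂ) (Y : Matrix m o ℂ) :
    numeric A (X * Y) = numeric A X * numeric A Y :=
  Matrix.map_mul

theorem numeric_one [DecidableEq m] : numeric A (1 : Matrix m m ℂ) = 1 :=
  Matrix.map_one _ (map_zero _) (map_one _)

theorem numeric_smul (c : ℂ) (X : Matrix l m ℂ) : numeric A (c • X) = c • numeric A X := by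
  ext a b
  simp [numeric, Algebra.smul_def]

theorem numeric_legs {N p n : ℕ} (X : TensorOp N p ℂ) (s : ℕ) :
    numeric A (legs X n s) = legs (numeric A X) n s :=
  legs_map _ (map_zero _) X s

/-- Multiplication by an element of the coefficient algebra. -/
def scalarOp (ι : Type*) [DecidableEq ι] (x : A) : Matrix ι ι A := diagonal fun _ => x

theorem scalarOp_mul_numeric [DecidableEq l] [Fintype l] [DecidableEq m] [Fintype m] (x : A)
    (X : Matrix l m ℂ) : scalarOp l x * numeric A X = numeric A X * scalarOp m x := by
  ext a b
  rw [scalarOp, scalarOp, diagonal_mul, mul_diagonal]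
  exact (Algebra.commutes (X a b) x).symm

end Numeric

/-! ### Factorization through one leg and partial traces -/

section OneLeg
variable {N k : ℕ} {A : Type*}

/-- A matrix as an operator on `V^{⊗1}`. -/
def oneLeg (X : Matrix (Fin N) (Fin N) A) : TensorOp N 1 A := fun a b => X (a 0) (b 0)

/-- The map `x ↦ x ⊗ u` as a rectangular matrix. -/
def tailCol (u : (Fin k → Fin N) → ℂ) : Matrix (Fin (k + 1) → Fin N) (Fin N) ℂ :=
  of fun a x => if a 0 = x then u (fun t => a t.succ) else 0

theorem legs_oneLeg_mul_tailCol [Ring A] [Algebra ℂ A] (X : Matrix (Fin N) (Fin N) A)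
    (u : (Fin k → Fin N) → ℂ) :
    legs (oneLeg X) (k + 1) 0 * numeric A (tailCol u) = numeric A (tailCol u) * X := by
  ext a b
  rw [mul_apply, mul_apply, Finset.sum_eq_single (Fin.cons b fun t => a t.succ),
    Finset.sum_eq_single (a 0)]
  · simp only [numeric, tailCol, map_apply, of_apply, Fin.cons_zero, Fin.cons_succ, if_true]
    rw [Algebra.commutes, legs, dif_pos (by omega), if_pos]
    · rfl
    · intro j hj
      obtain ⟨t, rfl⟩ := Fin.exists_succ_eq.mpr (show j ≠ 0 by rintro rfl; simp at hj)
      simp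
  · intro x _ hx
    simp [numeric, tailCol, hx.symm]
  · simp
  · intro c _ hc
    by_cases h1 : c 0 = b
    · rw [legs, dif_pos (by omega), if_neg, zero_mul]
      intro h2
      apply hc
      funext j
      refine Fin.cases ?_ (fun t => ?_) j
      · simp [h1]
      · rw [Fin.cons_succ, h2 t.succ (by simp)]
    · simp [numeric, tailCol, h1]
  · simp

theorem tailCol_transpose_mul_legs_oneLeg [Ring A] [Algebra ℂ A] (X : Matrix (Fin N) (Fin N) A)
    (v : (Fin k → Fin N) → ℂ) :
    numeric A ((tailCol v)ᵀ) * legs (oneLeg X) (k + 1) 0 = X * numeric A ((tailCol v)ᵀ) := by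
  ext a b
  rw [mul_apply, mul_apply, Finset.sum_eq_single (Fin.cons a fun t => b t.succ),
    Finset.sum_eq_single (b 0)]
  · simp only [numeric, tailCol, map_apply, of_apply, transpose_apply, Fin.cons_zero, Fin.cons_succ,
      if_true]
    rw [Algebra.commutes, legs, dif_pos (by omega), if_pos]
    · rfl
    · intro j hj
      obtain ⟨t, rfl⟩ := Fin.exists_succ_eq.mpr (show j ≠ 0 by rintro rfl; simp at hj)
      simp
  · intro x _ hx
    simp [numeric, tailCol, hx.symm]
  · simp
  · intro c _ hc
    by_cases h1 : c 0 = a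
    · rw [legs, dif_pos (by omega), if_neg, mul_zero]
      intro h2
      apply hc
      funext j
      refine Fin.cases ?_ (fun t => ?_) j
      · simp [h1]
      · rw [Fin.cons_succ, ← h2 t.succ (by simp)]
    · simp [numeric, tailCol, h1]
  · simp

/-- A rank one operator on the last k legs factors through the first leg. This turns identities
containing a' into products of rectangular matrices. -/
theorem legs_vecMulVec (u v : (Fin k → Fin N) → ℂ) :
    legs (vecMulVec u v) (k + 1) 1 = tailCol u * (tailCol v)ᵀ := by
  ext a b
  rw [mul_apply, Finset.sum_eq_single (a 0)]
  · simp only [tailCol, of_apply, transpose_apply, if_true, legs, show 1 + k ≤ k + 1 by omega,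
      dite_true, mul_ite, mul_zero]
    have e : ∀ a : Fin (k + 1) → Fin N,
        (fun t : Fin k => a ⟨1 + t.1, by omega⟩) = fun t => a t.succ := fun a => by
      funext t; congr 1; ext; simp [add_comm]
    rw [e, e]
    refine if_congr ⟨fun h => (h 0 (by simp)).symm, fun h j hj => ?_⟩ rfl rfl
    have : j = 0 := by ext; change j.1 = 0; omega
    rw [this, h]
  · intro x _ hx
    simp [tailCol, hx.symm]
  · simp

theorem tailCol_transpose_mul_tailCol {u v : (Fin k → Fin N) → ℂ} (h : v ⬝ᵥ u = 1) :
    (tailCol v)ᵀ * tailCol u = 1 := by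
  ext x y
  rw [mul_apply, ← Fintype.sum_equiv (Fin.consEquiv fun _ : Fin (k + 1) => Fin N) (fun z =>
    (tailCol v)ᵀ x (Fin.cons z.1 z.2) * tailCol u (Fin.cons z.1 z.2) y) _ (fun z => rfl),
    Fintype.sum_prod_type]
  simp only [tailCol, transpose_apply, of_apply, Fin.cons_zero, Fin.cons_succ]
  rw [Finset.sum_eq_single x (fun z _ hz => by simp [hz]) (by simp)]
  by_cases hxy : x = y
  · subst hxy
    simpa [dotProduct] using h
  · simp [hxy]

/-- Cyclicity of the trace over the tail legs. It removes the partial trace from the definition of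
O; the transposed version does this for Õ. -/
theorem traceTail_tailCol_mul (u : (Fin k → Fin N) → ℂ)
    (Y : Matrix (Fin N) (Fin (k + 1) → Fin N) ℂ) :
    traceTail (tailCol u * Y) = Y * tailCol u := by
  ext x y
  rw [mul_apply, ← Fintype.sum_equiv (Fin.consEquiv fun _ : Fin (k + 1) => Fin N) (fun z =>
    Y x (Fin.cons z.1 z.2) * tailCol u (Fin.cons z.1 z.2) y) _ (fun z => rfl),
    Fintype.sum_prod_type, Finset.sum_eq_single y (fun z _ hz => by simp [tailCol, hz]) (by simp),
    traceTail]
  refine Finset.sum_congr rfl fun c _ => ?_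
  rw [mul_apply, Finset.sum_eq_single x (fun z _ hz => by simp [tailCol, hz.symm]) (by simp)]
  simp [tailCol, mul_comm]

theorem traceTail_mul_tailCol_transpose (v : (Fin k → Fin N) → ℂ)
    (Y : Matrix (Fin (k + 1) → Fin N) (Fin N) ℂ) :
    traceTail (Y * (tailCol v)ᵀ) = (tailCol v)ᵀ * Y := by
  ext x y
  rw [mul_apply, ← Fintype.sum_equiv (Fin.consEquiv fun _ : Fin (k + 1) => Fin N) (fun z =>
    (tailCol v)ᵀ x (Fin.cons z.1 z.2) * Y (Fin.cons z.1 z.2) y) _ (fun z => rfl),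
    Fintype.sum_prod_type, Finset.sum_eq_single x (fun z _ hz => by simp [tailCol, hz]) (by simp),
    traceTail]
  refine Finset.sum_congr rfl fun c _ => ?_
  rw [mul_apply, Finset.sum_eq_single y (fun z _ hz => by simp [tailCol, hz.symm]) (by simp)]
  simp [tailCol, mul_comm]

end OneLeg

/-! ### Nondegeneracy of κ -/

section Sandwich
variable {N k : ℕ} {q μ : ℂ} {R : (TensorOp N 2 ℂ)ˣ}

theorem kappa_legs (X : TensorOp N 2 ℂ) {n i : ℕ} (hi : i + 2 ≤ n) :
    kappa q μ (legs X n i) = legs (kappa q μ X) n i :=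
  (map_kappa (legsHom N ℂ hi) X).symm

theorem legs_antisymm (X : TensorOp N 2 ℂ) {n m j s t : ℕ} (hj : s + j ≤ m) (h : t + m ≤ n) :
    legs (antisymm q μ (fun i => legs X m (s + i)) j) n t =
      antisymm q μ (fun i => legs X n (t + (s + i))) j := by
  rw [← legsHom_apply h, map_antisymm]
  refine antisymm_congr j fun i hi => ?_
  rw [legsHom_apply, legs_legs X (by omega) h]

theorem antisymmShiftOp_eq_legs (k : ℕ) :
    antisymmShiftOp q μ R k = legs (antisymmOp q μ R k) (k + 1) 1 := by
  have h := legs_antisymm (q := q) (μ := μ) R.1 (n := k + 1) (m := k) (j := k) (s := 0) (t := 1)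
    (by omega) (by omega)
  simp only [zero_add] at h
  rw [antisymmOp]
  exact (antisymm_congr k fun i _ => by rw [Nat.add_comm i 1]).trans h.symm

/-- Nondegeneracy: a one-leg operator annihilated by `κ₁ · a^{(j)↑1}` is zero. -/
theorem Generic.eq_zero_of_kappa_mul (g : Generic q μ k)
    (h : ∀ n, BMWRelations q μ n (legs R.1 n) (legs (R⁻¹).1 n)) (hK : kappa q μ R.1 ≠ 0)
    (hδ : ∀ j, 1 ≤ j → j + 1 ≤ k → closingFactor q μ j ≠ 0) (Z : Matrix (Fin N) (Fin N) ℂ) :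
    ∀ j, j + 1 ≤ k → legs (kappa q μ R.1) (j + 2) 0 * legs (oneLeg Z) (j + 2) 0 *
      antisymm q μ (fun i => legs R.1 (j + 2) (1 + i)) (j + 1) = 0 → Z = 0
  | 0, _, hZ => by
    -- On three legs, Zκ₂ = κ₂κ₁κ₂Z = κ₂(κ₁Z)κ₂ = 0, so Z ⊗ K = 0 with K ≠ 0.
    have h3 := congrArg (fun X => legs X 3 0) hZ
    simp only [antisymm, mul_one, legs_zero] at h3
    rw [legs_mul _ _ (by omega), legs_legs _ (by omega) (by omega),
      legs_legs _ (by omega) (by omega)] at h3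
    have hr := (h 3).kappa_kappa_kappa 1 0 (by omega) (by omega) (Or.inr rfl)
    rw [kappa_legs _ (by omega), kappa_legs _ (by omega)] at hr
    have hc : Commute (legs (oneLeg Z) 3 0) (legs (kappa q μ R.1) 3 1) :=
      legs_commute _ _ (fun _ _ _ _ => Commute.all _ _) (by omega) (by omega) (Or.inl (by omega))
    have h4 : legs (oneLeg Z) 3 0 * legs (kappa q μ R.1) 3 1 = 0 := by
      rw [hc.eq, ← hr, mul_assoc, ← hc.eq, ← mul_assoc, mul_assoc (legs _ 3 1), h3, mul_zero,
        zero_mul]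
    have h5 := eq_zero_of_legs_mul_legs (p := 1) (r := 2) hK h4
    ext a b
    exact congrFun (congrFun h5 fun _ => a) fun _ => b
  | j + 1, hj, hZ => by
    refine g.eq_zero_of_kappa_mul h hK hδ Z j (by omega) ?_
    -- The shorter relation is proved after tensoring with K on two further legs. Sandwiching the
    -- longer relation, on one more leg, between two copies of this K closes its last leg and
    -- produces the shorter antisymmetrizer times a nonzero factor.
    refine eq_zero_of_legs_mul_legs (p := j + 2) (r := 2) hK ?_
    have hs : BMWRelations q μ (j + 3) (fun i => legs R.1 (j + 2 + 2) (1 + i))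
        (fun i => legs (R⁻¹).1 (j + 2 + 2) (1 + i)) := by
      simpa only [Nat.add_comm 1] using (h (j + 3 + 1)).shift
    have hl := g.kappa_antisymm_kappa_last hs (j := j) hj (by omega)
    have hZ' := congrArg (fun X => legs X (j + 2 + 2) 0) hZ
    simp only [legs_zero] at hZ'
    rw [legs_mul _ _ (by omega), legs_mul _ _ (by omega), legs_antisymm _ (by omega) (by omega),
      legs_legs _ (by omega) (by omega), legs_legs _ (by omega) (by omega)] at hZ'
    rw [legs_mul _ _ (by omega), legs_mul _ _ (by omega), legs_antisymm _ (by omega) (by omega),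
      legs_legs _ (by omega) (by omega), legs_legs _ (by omega) (by omega)]
    simp only [zero_add] at hZ' ⊢
    rw [show 1 + (j + 1) = j + 2 by omega, kappa_legs _ (by omega)] at hl
    have hc1 : Commute (legs (kappa q μ R.1) (j + 2 + 2) 0)
        (legs (kappa q μ R.1) (j + 2 + 2) (j + 2)) :=
      legs_commute _ _ (fun _ _ _ _ => Commute.all _ _) (by omega) (by omega) (Or.inl (by omega))
    have hc2 : Commute (legs (oneLeg Z) (j + 2 + 2) 0)
        (legs (kappa q μ R.1) (j + 2 + 2) (j + 2)) :=
      legs_commute _ _ (fun _ _ _ _ => Commute.all _ _) (by omega) (by omega) (Or.inl (by omega))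
    have hδ' := hδ (j + 1) (by omega) hj
    refine (smul_eq_zero_iff_right hδ').mp ?_
    rw [mul_assoc, ← mul_smul_comm, ← hl]
    generalize legs (kappa q μ R.1) (j + 2 + 2) (j + 2) = κ at *
    calc _ = κ * (legs (kappa q μ R.1) (j + 2 + 2) 0 * legs (oneLeg Z) (j + 2 + 2) 0 *
        antisymm q μ (fun i => legs R.1 (j + 2 + 2) (1 + i)) (j + 1 + 1)) * κ := by
          rw [mul_assoc κ, ← mul_assoc _ κ, (hc1.mul_left hc2).eq]
          simp only [mul_assoc]
      _ = 0 := by rw [hZ', mul_zero, zero_mul]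

end Sandwich

/-- A generator of the range gives the column and the coordinates of the columns of X give the row.
Idempotence multiplies a nonzero entry by the pairing of the two, which is therefore 1. -/
theorem exists_vecMulVec_of_rank_eq_one {ι : Type*} [Fintype ι] [DecidableEq ι] {X : Matrix ι ι ℂ}
    (h1 : X.rank = 1) (h2 : X * X = X) : ∃ u v : ι → ℂ, X = vecMulVec u v ∧ v ⬝ᵥ u = 1 := by
  obtain ⟨w, hw, hs⟩ := finrank_eq_one_iff'.mp h1
  choose c hc using fun j => hs ⟨X.mulVecLin (Pi.single j 1), LinearMap.mem_range_self _ _⟩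
  have hX : X = vecMulVec w.1 c := by
    ext i j
    have := congrFun (congrArg Subtype.val (hc j)) i
    simp only [mulVecLin_apply, mulVec_single_one, col_apply] at this
    rw [vecMulVec_apply, ← this, mul_comm]
    rfl
  refine ⟨w.1, c, hX, ?_⟩
  have hX0 : X ≠ 0 := by rintro rfl; simp at h1
  obtain ⟨i, j, hij⟩ : ∃ i j, X i j ≠ 0 := by
    by_contra! hh
    exact hX0 (Matrix.ext hh)
  have h3 : (c ⬝ᵥ w.1) * X i j = X i j := by
    conv_rhs => rw [← h2]
    rw [mul_apply, dotProduct, Finset.sum_mul]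
    refine Finset.sum_congr rfl fun l _ => ?_
    have hX' : ∀ i j, X i j = w.1 i * c j := fun i j => congrFun (congrFun hX i) j
    rw [hX' i j, hX' i l, hX' l j]
    ring
  exact mul_right_cancel₀ hij (h3.trans (one_mul _).symm)

theorem exists_eq_smul_of_smul_add_smul_eq_zero {E : Type*} [AddCommGroup E] [Module ℂ E]
    {c d : ℂ} {x y : E} (hd : d ≠ 0) (h : c • x + d • y = 0) : ∃ s : ℂ, y = s • x ∧ c + d * s = 0 := by
  refine ⟨-d⁻¹ * c, ?_, by rw [neg_mul, mul_neg, mul_inv_cancel_left₀ hd, add_neg_cancel]⟩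
  rw [add_comm, ← eq_neg_iff_add_eq_zero] at h
  rw [← one_smul ℂ y, ← inv_mul_cancel₀ hd, mul_smul, h]
  module

/-! ### The sandwich identity for the rank one antisymmetrizer -/

section Sandwich
variable {N k : ℕ} {q μ : ℂ} {R : (TensorOp N 2 ℂ)ˣ}

theorem antisymmOp_idem (g : Generic q μ k)
    (h : ∀ n, BMWRelations q μ n (legs R.1 n) (legs (R⁻¹).1 n)) :
    antisymmOp q μ R k * antisymmOp q μ R k = antisymmOp q μ R k :=
  g.antisymm_idem (h k) le_rfl le_rfl

theorem numeric_complex {l m : Type*} (X : Matrix l m ℂ) : numeric ℂ X = X :=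
  Matrix.map_id X

/-- `a κ₁ a = δ a` for the rank one antisymmetrizer `a = ρ_R(a^{(k)↑1})`. -/
theorem Generic.antisymm_kappa_antisymm (g : Generic q μ (k + 1))
    (h : ∀ n, BMWRelations q μ n (legs R.1 n) (legs (R⁻¹).1 n)) (hK : kappa q μ R.1 ≠ 0)
    (hδ : ∀ j, 1 ≤ j → j + 1 ≤ k + 1 → closingFactor q μ j ≠ 0)
    (h1 : (antisymmOp q μ R (k + 1)).rank = 1) :
    antisymmShiftOp q μ R (k + 1) * kappa q μ (legs R.1 (k + 1 + 1) 0) *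
      antisymmShiftOp q μ R (k + 1) = closingFactor q μ k • antisymmShiftOp q μ R (k + 1) := by
  obtain ⟨u, v, huv, hvu⟩ := exists_vecMulVec_of_rank_eq_one h1 (antisymmOp_idem g h)
  have ha : antisymmShiftOp q μ R (k + 1) = tailCol u * (tailCol v)ᵀ := by
    rw [antisymmShiftOp_eq_legs, huv, legs_vecMulVec]
  have ha1 : ∀ X : Matrix (Fin N) (Fin N) ℂ, legs (oneLeg X) (k + 1 + 1) 0 *
      antisymmShiftOp q μ R (k + 1) = tailCol u * X * (tailCol v)ᵀ := fun X => by
    have := legs_oneLeg_mul_tailCol X u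
    rw [numeric_complex] at this
    rw [ha, ← Matrix.mul_assoc, this]
  set κ := kappa q μ (legs R.1 (k + 1 + 1) 0) with hκ
  -- The defect of the claim as a one-leg operator: Z₁a' = a'κa' - δa'.
  set Z := (tailCol v)ᵀ * κ * tailCol u - closingFactor q μ k • 1 with hZ
  have ha2 : legs (oneLeg Z) (k + 1 + 1) 0 * antisymmShiftOp q μ R (k + 1) =
      antisymmShiftOp q μ R (k + 1) * κ * antisymmShiftOp q μ R (k + 1) -
        closingFactor q μ k • antisymmShiftOp q μ R (k + 1) := by
    rw [ha1, ha, hZ, Matrix.mul_sub, Matrix.sub_mul, Matrix.mul_smul, Matrix.mul_one,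
      Matrix.smul_mul]
    simp only [Matrix.mul_assoc]
  have hs := (h (k + 1 + 1)).shift
  have hl := g.sigma_antisymm hs (k + 1) le_rfl le_rfl
  have h2 := g.two_le
  obtain ⟨j, rfl⟩ := Nat.exists_eq_add_of_le' (show 1 ≤ k by omega)
  have hf := g.kappa_antisymm_kappa_first (h (j + 1 + 1 + 1)) (j := j) (by omega) (by omega)
  have habs : antisymm q μ (fun i => legs R.1 (j + 1 + 1 + 1) (i + 1 + 1)) (j + 1) *
      antisymmShiftOp q μ R (j + 1 + 1) = antisymmShiftOp q μ R (j + 1 + 1) :=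
    g.antisymm_mul (j + 1) (by omega) fun i hi => (hl (i + 1) (by omega)).1
  have hc : Commute (antisymm q μ (fun i => legs R.1 (j + 1 + 1 + 1) (i + 1 + 1)) (j + 1)) κ :=
    kappa_commute (antisymm_commute _ fun i hi =>
      (h (j + 1 + 1 + 1)).comm _ _ (by omega) (by omega)).symm
  have hZ0 : Z = 0 := by
    refine g.eq_zero_of_kappa_mul h hK hδ Z (j + 1) le_rfl ?_
    have e : antisymm q μ (fun i => legs R.1 (j + 1 + 2) (1 + i)) (j + 1 + 1) =
        antisymmShiftOp q μ R (j + 1 + 1) :=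
      antisymm_congr _ fun i _ => by rw [Nat.add_comm 1 i]
    rw [e, ← kappa_legs _ (by omega), mul_assoc, ha2, mul_sub, ← mul_assoc, ← mul_assoc]
    change κ * antisymm q μ (fun i => legs R.1 (j + 1 + 1 + 1) (i + 1)) (j + 2) * κ * _ - _ = 0
    -- κa'κ = δa''κ, where a'' is the antisymmetrizer with the first leg of a' removed; it commutes
    -- with κ and is absorbed by a'. Hence κ(a'κa' - δa') = 0.
    rw [hf, smul_mul_assoc, hc.eq, mul_assoc, habs, mul_smul_comm, sub_self]
  rw [← sub_eq_zero, ← ha2, hZ0]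
  exact (congrArg (· * _) (legs_zero 0)).trans (zero_mul _)

/-- `a^{(k)↑1} a^{(k)} a^{(k)↑1}` is a multiple of `a^{(k)↑1}` for `R` of type `O(k)`. -/
theorem IsOrthogonal.shift_mul_mul_shift (hR : IsOrthogonal q k R) :
    (oFactor q k * oFactor q k) • (antisymmShiftOp q (muO q k) R k *
      legs (antisymmOp q (muO q k) R k) (k + 1) 0 * antisymmShiftOp q (muO q k) R k) =
      antisymmShiftOp q (muO q k) R k := by
  have g := hR.height.generic
  have h2 := g.two_le
  obtain ⟨j, rfl⟩ := Nat.exists_eq_add_of_le' h2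
  have hB := hR.height.bmw
  have h := hB.relations
  have hκ := g.antisymm_kappa_antisymm (k := j + 1) h hB.kappa_ne_zero
    (fun i hi hi' => g.closingFactor_ne_zero hi hi' (muO_sq_mul_pow_ne g hi')) hR.rank_one
  have hs := (h (j + 2 + 1)).shift
  have hidem : antisymmShiftOp q (muO q (j + 2)) R (j + 2) *
      antisymmShiftOp q (muO q (j + 2)) R (j + 2) =
      antisymmShiftOp q (muO q (j + 2)) R (j + 2) := g.antisymm_idem hs le_rfl le_rfl
  have hv := hR.height.vanish
  have hM : legs (antisymmOp q (muO q (j + 2)) R (j + 2)) (j + 2 + 1) 0 =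
      antisymm q (muO q (j + 2)) (legs R.1 (j + 2 + 1)) (j + 2) := by
    have := legs_antisymm (q := q) (μ := muO q (j + 2)) R.1 (n := j + 2 + 1) (m := j + 2)
      (j := j + 2) (s := 0) (t := 0) (by omega) (by omega)
    simp only [zero_add] at this
    exact this
  have hsub := g.mul_antisymm (σ := fun i => legs R.1 (j + 2 + 1) (i + 1))
    (x := antisymmShiftOp q (muO q (j + 2)) R (j + 2)) (j + 1) (by omega)
    fun i hi => (g.sigma_antisymm hs (j + 2) le_rfl le_rfl i (by omega)).2
  have hsub' := g.antisymm_mul (σ := fun i => legs R.1 (j + 2 + 1) (i + 1))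
    (x := antisymmShiftOp q (muO q (j + 2)) R (j + 2)) (j + 1) (by omega)
    fun i hi => (g.sigma_antisymm hs (j + 2) le_rfl le_rfl i (by omega)).1
  rw [hM, g.antisymm_succ_left ((h (j + 2 + 1)).of_le (by omega)) le_rfl]
  generalize antisymmShiftOp q (muO q (j + 2)) R (j + 2) = a at *
  generalize antisymm q (muO q (j + 2)) (fun i => legs R.1 (j + 2 + 1) (i + 1)) (j + 1) = b at *
  have hx : ∀ x, a * baxterMinus q (muO q (j + 2)) x (legs R.1 (j + 2 + 1) 0) * a =
      (1 + muO q (j + 2) * (x - 1) / (muO q (j + 2) + q * x) *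
        closingFactor q (muO q (j + 2)) (j + 1)) • a +
      ((x - 1) / (q - q⁻¹)) • (a * legs R.1 (j + 2 + 1) 0 * a) := fun x => by
    rw [baxterMinus, mul_add, mul_add, add_mul, add_mul, mul_one, hidem, mul_smul_comm,
      mul_smul_comm, smul_mul_assoc, smul_mul_assoc, hκ]
    module
  have hp := g.pow_ne (j + 2) (by omega) le_rfl
  have hf : ((q ^ (2 * (j + 1 + 1)))⁻¹ - 1) / (q - q⁻¹) ≠ 0 :=
    div_ne_zero (sub_ne_zero.mpr fun h => hp (inv_eq_one.mp h)) g.sub_inv_ne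
  rw [hx] at hv
  -- Since aκ₁a is already a multiple of a, the vanishing condition forces aσ₁a to be one too and
  -- fixes the scalar.
  obtain ⟨s, hs1, hs2⟩ : ∃ s : ℂ, a * legs R.1 (j + 2 + 1) 0 * a = s • a ∧
      1 + muO q (j + 2) * ((q ^ (2 * (j + 1 + 1)))⁻¹ - 1) /
        (muO q (j + 2) + q * (q ^ (2 * (j + 1 + 1)))⁻¹) *
        closingFactor q (muO q (j + 2)) (j + 1) +
          ((q ^ (2 * (j + 1 + 1)))⁻¹ - 1) / (q - q⁻¹) * s = 0 := by
    exact exists_eq_smul_of_smul_add_smul_eq_zero hf hv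
  have hfin := middle_factor (k := j + 1) g hB.mu_ne.2.2 (s := s) (by rw [← hs2]; ring)
  rw [mul_smul_comm, smul_mul_assoc, ← mul_assoc, ← mul_assoc, hsub, mul_assoc, hsub', hx, hs1]
  conv_rhs => rw [← one_smul ℂ a, ← hfin]
  module

end Sandwich

/-! ### Intertwiners of antisymmetrizers -/

section Semiconj
variable {A : Type*} [Ring A] [Algebra ℂ A] {q μ : ℂ}

theorem SemiconjBy.smul_right' {x σ σ' : A} (c : ℂ) (h : SemiconjBy x σ σ') :
    SemiconjBy x (c • σ) (c • σ') := by
  rw [SemiconjBy, mul_smul_comm, smul_mul_assoc, h.eq]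

theorem kappa_semiconjBy {x σ σ' : A} (h : SemiconjBy x σ σ') :
    SemiconjBy x (kappa q μ σ) (kappa q μ σ') :=
  SemiconjBy.smul_right' _ ((((SemiconjBy.smul_right' q (SemiconjBy.one_right x)).sub_right h)).mul_right
    ((SemiconjBy.smul_right' q⁻¹ (SemiconjBy.one_right x)).add_right h))

theorem baxterMinus_semiconjBy {x σ σ' : A} (y : ℂ) (h : SemiconjBy x σ σ') :
    SemiconjBy x (baxterMinus q μ y σ) (baxterMinus q μ y σ') :=
  ((SemiconjBy.one_right x).add_right (SemiconjBy.smul_right' _ h)).add_right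
    (SemiconjBy.smul_right' _ (kappa_semiconjBy h))

theorem antisymm_semiconjBy {x : A} {σ σ' : ℕ → A} :
    ∀ j : ℕ, (∀ i, i + 1 < j → SemiconjBy x (σ i) (σ' i)) →
      SemiconjBy x (antisymm q μ σ j) (antisymm q μ σ' j)
  | 0, _ => SemiconjBy.one_right x
  | 1, _ => SemiconjBy.one_right x
  | j + 2, h => by
    have ih := antisymm_semiconjBy (j + 1) fun i hi => h i (by omega)
    exact SemiconjBy.smul_right' _
      ((ih.mul_right (baxterMinus_semiconjBy _ (h j (by omega)))).mul_right ih)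

end Semiconj

/-! ### Braid transport of generators and of matrix copies -/

section Twist
variable {B : Type*} [Monoid B] {n : ℕ} {x f f' m : ℕ → B}

/-- The relations between `n - 1` braid generators `f`, with inverses `f'`, and operators `x` that
are twisted by them. -/
structure Twisted (n : ℕ) (x f f' : ℕ → B) : Prop where
  mul_inv : ∀ i, i + 1 < n → f i * f' i = 1
  inv_mul : ∀ i, i + 1 < n → f' i * f i = 1
  comm : ∀ i j, i + 1 < n → j + 1 < n → (i + 1 < j ∨ j + 1 < i) → Commute (x i) (f j)
  twist₁ : ∀ i, i + 2 < n → x i * f (i + 1) * f i = f (i + 1) * f i * x (i + 1)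
  twist₂ : ∀ i, i + 2 < n → x (i + 1) * f i * f (i + 1) = f i * f (i + 1) * x i

theorem commute_inv_of_commute {a b b' : B} (h : Commute a b) (h1 : b * b' = 1) (h2 : b' * b = 1) :
    Commute a b' := by
  calc a * b' = b' * b * a * b' := by rw [h2, one_mul]
    _ = b' * (b * a) * b' := by rw [mul_assoc b']
    _ = b' * a := by rw [← h.eq, mul_assoc, mul_assoc, h1, mul_one]

theorem Twisted.comm_inv (h : Twisted n x f f') {i j : ℕ} (hi : i + 1 < n) (hj : j + 1 < n)
    (hij : i + 1 < j ∨ j + 1 < i) : Commute (x i) (f' j) :=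
  commute_inv_of_commute (h.comm i j hi hj hij) (h.mul_inv j hj) (h.inv_mul j hj)

/-- Copies of an operator on the first leg, transported by the braid generators. -/
structure Copies (n : ℕ) (x f f' m : ℕ → B) : Prop where
  succ : ∀ i, i + 1 < n → m (i + 1) = f i * m i * f' i
  comm_zero : ∀ i, 1 ≤ i → i + 1 < n → Commute (x i) (m 0)

theorem Copies.comm_of_lt (h : Twisted n x f f') (hm : Copies n x f f' m) {i : ℕ}
    (hi : i + 1 < n) : ∀ j, j < i → Commute (x i) (m j)
  | 0, hj => hm.comm_zero i hj hi
  | j + 1, hj => by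
    rw [hm.succ j (by omega)]
    exact ((h.comm i j hi (by omega) (by omega)).mul_right
      (Copies.comm_of_lt h hm hi j (by omega))).mul_right (h.comm_inv hi (by omega) (by omega))

theorem Twisted.twist₁_inv (h : Twisted n x f f') {i : ℕ} (hi : i + 2 < n) :
    f' i * f' (i + 1) * x i = x (i + 1) * f' i * f' (i + 1) := by
  have h1 := h.inv_mul i (by omega)
  have h2 := h.inv_mul (i + 1) (by omega)
  have h1' := h.mul_inv i (by omega)
  have h2' := h.mul_inv (i + 1) (by omega)
  calc f' i * f' (i + 1) * x i = f' i * f' (i + 1) * x i * f (i + 1) * (f i * f' i) * f' (i + 1) := by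
        rw [h1', mul_one, mul_assoc _ (f (i + 1)), h2', mul_one]
    _ = f' i * f' (i + 1) * (x i * f (i + 1) * f i) * f' i * f' (i + 1) := by
        simp only [mul_assoc]
    _ = f' i * (f' (i + 1) * f (i + 1)) * f i * x (i + 1) * f' i * f' (i + 1) := by
        rw [h.twist₁ i hi]; simp only [mul_assoc]
    _ = _ := by rw [h2, mul_one, h1, one_mul]

/-- For the copy i + 2, moving x_i through f_{i+1}f_i turns it into x_{i+1}, which commutes with
m_i, and moving on through the inverses restores x_i. Further copies differ by conjugation with
distant generators. -/
theorem Copies.comm_of_gt (h : Twisted n x f f') (hm : Copies n x f f' m) {i : ℕ} :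
    ∀ j, i + 2 + j < n → Commute (x i) (m (i + 2 + j))
  | 0, hj => by
    rw [add_zero, hm.succ (i + 1) (by omega), hm.succ i (by omega)]
    have hc := Copies.comm_of_lt h hm (i := i + 1) (by omega) i (by omega)
    calc x i * (f (i + 1) * (f i * m i * f' i) * f' (i + 1))
        = x i * f (i + 1) * f i * m i * f' i * f' (i + 1) := by simp only [mul_assoc]
      _ = f (i + 1) * f i * (x (i + 1) * m i) * f' i * f' (i + 1) := by
          rw [h.twist₁ i (by omega)]; simp only [mul_assoc]
      _ = f (i + 1) * f i * m i * (x (i + 1) * f' i * f' (i + 1)) := by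
          rw [hc.eq]; simp only [mul_assoc]
      _ = f (i + 1) * (f i * m i * f' i) * f' (i + 1) * x i := by
          rw [← h.twist₁_inv (by omega)]; simp only [mul_assoc]
  | j + 1, hj => by
    rw [show i + 2 + (j + 1) = i + 2 + j + 1 by omega, hm.succ _ (by omega)]
    exact ((h.comm i _ (by omega) (by omega) (by omega)).mul_right
      (Copies.comm_of_gt h hm j (by omega))).mul_right (h.comm_inv (by omega) (by omega) (by omega))

theorem Copies.comm_of_add_two_le (h : Twisted n x f f') (hm : Copies n x f f' m) {i j : ℕ}
    (hij : i + 2 ≤ j) (hj : j < n) : Commute (x i) (m j) := by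
  obtain ⟨l, rfl⟩ := Nat.exists_eq_add_of_le hij
  exact Copies.comm_of_gt h hm l hj

/-- The relation between the first two copies propagates to all consecutive copies. -/
theorem Copies.comm_pair (h : Twisted n x f f') (hf : Twisted n f f f')
    (hm : Copies n x f f' m) (hmf : Copies n f f f' m) (h0 : Commute (x 0) (m 0 * m 1)) :
    ∀ i, i + 1 < n → Commute (x i) (m i * m (i + 1))
  | 0, _ => h0
  | i + 1, hi => by
    have ih := Copies.comm_pair h hf hm hmf h0 i (by omega)
    have c1 := Copies.comm_of_lt hf hmf (i := i + 1) (by omega) i (by omega)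
    have c2 := Copies.comm_of_add_two_le hf hmf (i := i) (j := i + 2) le_rfl (by omega)
    -- Conjugation by f_i f_{i+1} shifts the pair of copies by one; the second twist relation shifts
    -- x_i to x_{i+1} likewise.
    have e : m (i + 1) * m (i + 1 + 1) * (f i * f (i + 1)) =
        f i * f (i + 1) * (m i * m (i + 1)) := by
      calc m (i + 1) * m (i + 1 + 1) * (f i * f (i + 1))
          = m (i + 1) * (m (i + 2) * f i) * f (i + 1) := by simp only [mul_assoc]
        _ = f i * m i * (f' i * f i) * (f (i + 1) * m (i + 1) * (f' (i + 1) * f (i + 1))) := by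
            rw [← c2.eq, hm.succ i (by omega), hm.succ (i + 1) (by omega), hm.succ i (by omega)]
            simp only [mul_assoc]
        _ = f i * (m i * f (i + 1)) * m (i + 1) := by
            rw [h.inv_mul i (by omega), h.inv_mul (i + 1) (by omega), mul_one, mul_one]
            simp only [mul_assoc]
        _ = _ := by rw [← c1.eq]; simp only [mul_assoc]
    have hu : (f i * f (i + 1)) * (f' (i + 1) * f' i) = 1 := by
      rw [mul_assoc, ← mul_assoc (f (i + 1)), h.mul_inv _ (by omega), one_mul,
        h.mul_inv _ (by omega)]
    have ht : x (i + 1) * (f i * f (i + 1)) = f i * f (i + 1) * x i := by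
      rw [← mul_assoc]; exact h.twist₂ i hi
    generalize f i * f (i + 1) = y at *
    generalize f' (i + 1) * f' i = y' at *
    generalize m i * m (i + 1) = p at *
    generalize m (i + 1) * m (i + 1 + 1) = p' at *
    calc x (i + 1) * p' = x (i + 1) * (p' * y) * y' := by
          rw [mul_assoc, mul_assoc, hu, mul_one]
      _ = x (i + 1) * y * p * y' := by rw [e]; simp only [mul_assoc]
      _ = y * (x i * p) * y' := by rw [ht]; simp only [mul_assoc]
      _ = p' * (y * x i) * y' := by rw [ih.eq, ← mul_assoc, ← e]; simp only [mul_assoc]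
      _ = p' * x (i + 1) := by rw [← ht, mul_assoc, mul_assoc, hu, mul_one]

theorem prod_range_succ (m : ℕ → B) (l : ℕ) :
    ((List.range (l + 1)).map m).prod = ((List.range l).map m).prod * m l := by
  simp [List.range_succ]

theorem prod_range_reverse_succ (m : ℕ → B) (l : ℕ) :
    ((List.range (l + 1)).reverse.map m).prod = m l * ((List.range l).reverse.map m).prod := by
  simp [List.range_succ]

theorem commute_prod_range {a : B} {m : ℕ → B} :
    ∀ l : ℕ, (∀ i, i < l → Commute a (m i)) → Commute a ((List.range l).map m).prod
  | 0, _ => Commute.one_right a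
  | l + 1, h => by
    rw [prod_range_succ]
    exact (commute_prod_range l fun i hi => h i (by omega)).mul_right (h l (by omega))

theorem commute_prod_range_reverse {a : B} {m : ℕ → B} :
    ∀ l : ℕ, (∀ i, i < l → Commute a (m i)) → Commute a ((List.range l).reverse.map m).prod
  | 0, _ => Commute.one_right a
  | l + 1, h => by
    rw [prod_range_reverse_succ]
    exact (h l (by omega)).mul_right (commute_prod_range_reverse l fun i hi => h i (by omega))

/-- x_i commutes with all copies before i and after i + 1, and with the product of the two remaining
ones. -/
theorem Copies.comm_prod (h : Twisted n x f f') (hf : Twisted n f f f')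
    (hm : Copies n x f f' m) (hmf : Copies n f f f' m) (h0 : Commute (x 0) (m 0 * m 1)) {i : ℕ} :
    ∀ l, l ≤ n → i + 1 < l → Commute (x i) ((List.range l).map m).prod
  | 0, _, hi => by omega
  | l + 1, hl, hi => by
    rw [prod_range_succ]
    rcases Nat.lt_or_ge (i + 1) l with hil | hil
    · exact (Copies.comm_prod h hf hm hmf h0 l (by omega) hil).mul_right
        (Copies.comm_of_add_two_le h hm (by omega) (by omega))
    · obtain rfl : l = i + 1 := by omega
      rw [prod_range_succ, mul_assoc]
      exact (commute_prod_range i fun j hj => Copies.comm_of_lt h hm (by omega) j hj).mul_right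
        (Copies.comm_pair h hf hm hmf h0 i (by omega))

/-- Only the factor f_{i+1}f_i acts on x_{i+1}, lowering its index by the first twist relation; the
factors around it are distant. The ascending product raises indices by the second relation. -/
theorem Twisted.semiconjBy_descending (h : Twisted n x f f') {i : ℕ} :
    ∀ l, l < n → i + 1 < l →
      SemiconjBy ((List.range l).reverse.map f).prod (x (i + 1)) (x i)
  | 0, _, hi => by omega
  | l + 1, hl, hi => by
    rw [prod_range_reverse_succ]
    rcases Nat.lt_or_ge (i + 1) l with hil | hil
    · exact SemiconjBy.mul_left (h.comm i l (by omega) (by omega) (by omega)).symm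
        (h.semiconjBy_descending l (by omega) hil)
    · obtain rfl : l = i + 1 := by omega
      rw [prod_range_reverse_succ, ← mul_assoc]
      have hc : Commute (x (i + 1)) ((List.range i).reverse.map f).prod :=
        commute_prod_range_reverse i fun j hj => h.comm _ _ (by omega) (by omega) (by omega)
      refine SemiconjBy.mul_left ?_ hc.symm
      rw [SemiconjBy, ← h.twist₁ i (by omega), mul_assoc]

theorem Twisted.semiconjBy_ascending (h : Twisted n x f f') {i : ℕ} :
    ∀ l, l < n → i + 1 < l →
      SemiconjBy ((List.range l).map f).prod (x i) (x (i + 1))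
  | 0, _, hi => by omega
  | l + 1, hl, hi => by
    rw [prod_range_succ]
    rcases Nat.lt_or_ge (i + 1) l with hil | hil
    · exact SemiconjBy.mul_left (h.semiconjBy_ascending l (by omega) hil)
        (h.comm i l (by omega) (by omega) (by omega)).symm
    · obtain rfl : l = i + 1 := by omega
      rw [prod_range_succ, mul_assoc]
      have hc : Commute (x (i + 1)) ((List.range i).map f).prod :=
        commute_prod_range i fun j hj => h.comm _ _ (by omega) (by omega) (by omega)
      refine SemiconjBy.mul_left hc.symm ?_
      rw [SemiconjBy, ← h.twist₂ i (by omega), mul_assoc]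

theorem prod_range_mul_prod_range_reverse :
    ∀ l : ℕ, (∀ i, i < l → f i * f' i = 1) →
      ((List.range l).map f).prod * ((List.range l).reverse.map f').prod = 1
  | 0, _ => mul_one 1
  | l + 1, h => by
    rw [prod_range_succ, prod_range_reverse_succ, mul_assoc, ← mul_assoc (f l), h l (by omega),
      one_mul, prod_range_mul_prod_range_reverse l fun i hi => h i (by omega)]

theorem prod_range_reverse_mul_prod_range :
    ∀ l : ℕ, (∀ i, i < l → f i * f' i = 1) →
      ((List.range l).reverse.map f).prod * ((List.range l).map f').prod = 1
  | 0, _ => mul_one 1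
  | l + 1, h => by
    rw [prod_range_succ, prod_range_reverse_succ, mul_assoc, ← mul_assoc _ _ (f' l),
      prod_range_reverse_mul_prod_range l fun i hi => h i (by omega), one_mul, h l (by omega)]

theorem Copies.eq_conj (hm : Copies n x f f' m) :
    ∀ l, l < n → m l = ((List.range l).reverse.map f).prod * m 0 * ((List.range l).map f').prod
  | 0, _ => by simp
  | l + 1, hl => by
    rw [prod_range_reverse_succ, prod_range_succ, hm.succ l hl, Copies.eq_conj hm l (by omega)]
    simp only [mul_assoc]

/-- The factor f_i sends m_i to m_{i+1} by definition of the copies; later factors commute with m_i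
and earlier ones with m_{i+1}. -/
theorem Copies.ascending_mul (hf : Twisted n f f f') (hm : Copies n f f f' m) {i : ℕ} :
    ∀ l, l < n → i < l → SemiconjBy ((List.range l).map f).prod (m i) (m (i + 1))
  | 0, _, hi => by omega
  | l + 1, hl, hi => by
    rw [prod_range_succ]
    rcases Nat.lt_or_ge i l with hil | hil
    · exact SemiconjBy.mul_left (Copies.ascending_mul hf hm l (by omega) hil)
        (Copies.comm_of_lt hf hm (by omega) i hil)
    · obtain rfl : i = l := by omega
      have hc : Commute (m (i + 1)) ((List.range i).map f).prod :=
        commute_prod_range i fun j hj =>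
          (Copies.comm_of_add_two_le hf hm (by omega) (by omega)).symm
      refine SemiconjBy.mul_left hc.symm ?_
      rw [SemiconjBy, hm.succ i (by omega), mul_assoc _ (f' i), hf.inv_mul i (by omega), mul_one]

theorem semiconjBy_prod_range {y : B} {m m' : ℕ → B} :
    ∀ l : ℕ, (∀ i, i < l → SemiconjBy y (m i) (m' i)) →
      SemiconjBy y ((List.range l).map m).prod ((List.range l).map m').prod
  | 0, _ => SemiconjBy.one_right y
  | l + 1, h => by
    rw [prod_range_succ, prod_range_succ]
    exact (semiconjBy_prod_range l fun i hi => h i (by omega)).mul_right (h l (by omega))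

end Twist

/-! ### Realization by matrices and the relations of the quantum matrix -/

section Main
variable {N k : ℕ} {q : ℂ} {R F : (TensorOp N 2 ℂ)ˣ} {A : Type*} [Ring A] [Algebra ℂ A]

/-- Extension of scalars as a homomorphism of algebras. -/
def numericHom (ι : Type*) [Fintype ι] [DecidableEq ι] (A : Type*) [Ring A] [Algebra ℂ A] :
    Matrix ι ι ℂ →ₐ[ℂ] Matrix ι ι A :=
  (Algebra.ofId ℂ A).mapMatrix

theorem numericHom_apply {ι : Type*} [Fintype ι] [DecidableEq ι] (X : Matrix ι ι ℂ) :
    numericHom ι A X = numeric A X := rfl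

theorem Twisted.map {B C : Type*} [Monoid B] [Monoid C] {n : ℕ} {x f f' : ℕ → B}
    (h : Twisted n x f f') (φ : B →* C) :
    Twisted n (fun i => φ (x i)) (fun i => φ (f i)) (fun i => φ (f' i)) where
  mul_inv i hi := by rw [← map_mul, h.mul_inv i hi, map_one]
  inv_mul i hi := by rw [← map_mul, h.inv_mul i hi, map_one]
  comm i j hi hj hij := (h.comm i j hi hj hij).map φ
  twist₁ i hi := by simp only [← map_mul, h.twist₁ i hi]
  twist₂ i hi := by simp only [← map_mul, h.twist₂ i hi]

theorem twisted_legs {X : TensorOp N 2 ℂ}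
    (h1 : legs X 3 0 * legs F.1 3 1 * legs F.1 3 0 = legs F.1 3 1 * legs F.1 3 0 * legs X 3 1)
    (h2 : legs X 3 1 * legs F.1 3 0 * legs F.1 3 1 = legs F.1 3 0 * legs F.1 3 1 * legs X 3 0)
    (n : ℕ) : Twisted n (legs X n) (legs F.1 n) (legs (F⁻¹).1 n) where
  mul_inv i hi := by
    rw [← legs_mul _ _ (by omega), Units.mul_inv, legs_one (by omega)]
  inv_mul i hi := by
    rw [← legs_mul _ _ (by omega), Units.inv_mul, legs_one (by omega)]
  comm i j hi hj hij := legs_commute _ _ (fun _ _ _ _ => Commute.all _ _) (by omega) (by omega)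
    (by omega)
  twist₁ i hi := by
    have := congrArg (fun Y => legs Y n i) h1
    simpa only [legs_mul _ _ (show i + 3 ≤ n by omega),
      legs_legs _ (show 0 + 2 ≤ 3 by omega) (show i + 3 ≤ n by omega),
      legs_legs _ (show 1 + 2 ≤ 3 by omega) (show i + 3 ≤ n by omega), add_zero] using this
  twist₂ i hi := by
    have := congrArg (fun Y => legs Y n i) h2
    simpa only [legs_mul _ _ (show i + 3 ≤ n by omega),
      legs_legs _ (show 0 + 2 ≤ 3 by omega) (show i + 3 ≤ n by omega),
      legs_legs _ (show 1 + 2 ≤ 3 by omega) (show i + 3 ≤ n by omega), add_zero] using this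

theorem IsCompatiblePair.twisted_left (h : IsCompatiblePair R F) (n : ℕ) :
    Twisted n (legs R.1 n) (legs F.1 n) (legs (F⁻¹).1 n) :=
  twisted_legs h.twist₁ h.twist₂ n

theorem IsCompatiblePair.twisted_right (h : IsCompatiblePair R F) (n : ℕ) :
    Twisted n (legs F.1 n) (legs F.1 n) (legs (F⁻¹).1 n) :=
  twisted_legs h.yangBaxter_right h.yangBaxter_right.symm n

theorem copies_copy (X : TensorOp N 2 ℂ) (F : (TensorOp N 2 ℂ)ˣ) (M : Matrix (Fin N) (Fin N) A)
    (n : ℕ) : Copies n (fun i => numeric A (legs X n i)) (fun i => numeric A (legs F.1 n i))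
      (fun i => numeric A (legs (F⁻¹).1 n i)) (copy F M n) where
  succ i hi := rfl
  comm_zero i hi hn := by
    rw [numeric_legs]
    exact legs_commute _ _ (fun _ _ _ _ => Algebra.commutes _ _) (by omega) (by omega)
      (Or.inr (by omega))

theorem copy_zero (M : Matrix (Fin N) (Fin N) A) (n : ℕ) :
    copy F M n 0 = legs (oneLeg M) n 0 := rfl

theorem legs_copy (M : Matrix (Fin N) (Fin N) A) {l n : ℕ} (hl : l ≤ n) :
    ∀ i, i < l → legs (copy F M l i) n 0 = copy F M n i
  | 0, hi => legs_legs (oneLeg M) (by omega) (by omega)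
  | i + 1, hi => by
    rw [copy, legs_mul _ _ (by omega), legs_mul _ _ (by omega), legs_copy M hl i (by omega), copy]
    simp only [coeffs_eq_numeric]
    rw [← numeric_legs, ← numeric_legs, legs_legs _ (by omega) (by omega),
      legs_legs _ (by omega) (by omega), zero_add]

theorem quantumMatrix_relation :
    Commute (numeric (QMAlgebra R F) R.1)
      (copy F (quantumMatrix R F) 2 0 * copy F (quantumMatrix R F) 2 1) := by
  set φ : FreeAlgebra ℂ (Fin N × Fin N) →ₐ[ℂ] QMAlgebra R F := RingQuot.mkAlgHom ℂ (QMRel R F)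
    with hφ
  have hcoe : ∀ X : TensorOp N 2 ℂ, φ.mapMatrix (coeffs _ X) = numeric (QMAlgebra R F) X := by
    intro X
    ext a b
    exact φ.commutes _
  have hcopy : ∀ i, φ.mapMatrix (copy F (freeMatrix N) 2 i) = copy F (quantumMatrix R F) 2 i := by
    intro i
    induction i with
    | zero => exact legs_map _ (map_zero φ) (oneLeg (freeMatrix N)) 0
    | succ i ih => rw [copy, map_mul, map_mul, ih, hcoe, hcoe]; rfl
  have key : φ.mapMatrix (coeffs _ R.1 * copy F (freeMatrix N) 2 0 * copy F (freeMatrix N) 2 1) =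
      φ.mapMatrix (copy F (freeMatrix N) 2 0 * copy F (freeMatrix N) 2 1 * coeffs _ R.1) := by
    ext a b
    exact RingQuot.mkAlgHom_rel ℂ (QMRel.entry a b)
  simp only [map_mul, hcoe, hcopy] at key
  rw [Commute, SemiconjBy, ← mul_assoc, key]

theorem quantumMatrix_relation_legs {n : ℕ} (hn : 2 ≤ n) :
    Commute (numeric (QMAlgebra R F) (legs R.1 n 0))
      (copy F (quantumMatrix R F) n 0 * copy F (quantumMatrix R F) n 1) := by
  have := (quantumMatrix_relation (R := R) (F := F)).map
    (legsHom N (QMAlgebra R F) (show 0 + 2 ≤ n by omega))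
  simp only [map_mul, legsHom_apply] at this
  rwa [legs_copy _ hn 0 (by omega), legs_copy _ hn 1 (by omega), ← numeric_legs] at this

theorem scalarOp_mul {A : Type*} [Ring A] {ι κ : Type*} [Fintype ι] [DecidableEq ι] (x : A) (Y : Matrix ι κ A) :
    scalarOp ι x * Y = Y.map (x * ·) := by
  ext a b
  rw [scalarOp, diagonal_mul, map_apply]

theorem legs_scalarOp_mul {A : Type*} [Ring A] {p n : ℕ} (x : A) (Y : TensorOp N p A) (s : ℕ) :
    legs (scalarOp _ x * Y) n s = scalarOp _ x * legs Y n s := by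
  rw [scalarOp_mul, scalarOp_mul, legs_map _ (mul_zero x)]

theorem vecMulVec_eq_col_mul_row {ι : Type*} (u v : ι → ℂ) :
    vecMulVec u v = replicateCol Unit u * replicateRow Unit v :=
  vecMulVec_eq Unit u v

theorem eq_scalarOp_unit {A : Type*} [Ring A] (Y : Matrix Unit Unit A) : Y = scalarOp Unit (Y () ()) := by
  ext a b
  simp [scalarOp]

/-- A matrix that commutes with a numerical idempotent of rank one acts on it as a scalar. -/
theorem exists_mul_numeric_eq_scalarOp {ι : Type*} [Fintype ι] [DecidableEq ι] {u v : ι → ℂ}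
    {Y : Matrix ι ι A} (hvu : v ⬝ᵥ u = 1) (h : Commute (numeric A (vecMulVec u v)) Y) :
    ∃ m : A, Y * numeric A (vecMulVec u v) = scalarOp ι m * numeric A (vecMulVec u v) := by
  have hid : vecMulVec u v * vecMulVec u v = vecMulVec u v := by
    rw [vecMulVec_mul_vecMulVec, hvu, one_smul]
  let W : Matrix Unit Unit A :=
    numeric A (replicateRow Unit v) * Y * numeric A (replicateCol Unit u)
  refine ⟨W () (), ?_⟩
  calc Y * numeric A (vecMulVec u v)
      = numeric A (vecMulVec u v) * Y * numeric A (vecMulVec u v) := by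
        rw [h.eq, mul_assoc, ← numeric_mul, hid]
    _ = numeric A (replicateCol Unit u) * W * numeric A (replicateRow Unit v) := by
        simp only [W, vecMulVec_eq_col_mul_row, numeric_mul, Matrix.mul_assoc]
    _ = _ := by
        nth_rw 1 [eq_scalarOp_unit W]
        rw [← scalarOp_mul_numeric, vecMulVec_eq_col_mul_row,
          numeric_mul, Matrix.mul_assoc]

/-- The reason the quantum determinant is a complex multiple of the element by which the product of
copies acts on the antisymmetrizer. -/
theorem rTrace_scalarOp_mul {n : ℕ} (D : Matrix (Fin N) (Fin N) ℂ) (m : A) (X : TensorOp N n ℂ) :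
    rTrace D (scalarOp _ m * numeric A X) =
      (∑ a : Fin n → Fin N, ∑ b : Fin n → Fin N, (∏ j, D (a j) (b j)) * X b a) • m := by
  simp only [rTrace, Finset.sum_smul, scalarOp_mul, map_apply]
  refine Finset.sum_congr rfl fun a _ => Finset.sum_congr rfl fun b _ => ?_
  rw [numeric, map_apply, ← Algebra.commutes, ← Algebra.smul_def, smul_smul]

theorem numeric_antisymm {n : ℕ} (σ : ℕ → TensorOp N n ℂ) (μ : ℂ) (j : ℕ) :
    numeric A (antisymm q μ σ j) = antisymm q μ (fun i => numeric A (σ i)) j :=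
  map_antisymm (numericHom _ A) σ j

theorem numeric_prod {n : ℕ} (σ : ℕ → TensorOp N n ℂ) (l : List ℕ) :
    numeric A (l.map σ).prod = (l.map fun i => numeric A (σ i)).prod := by
  rw [← numericHom_apply, map_list_prod, List.map_map]
  rfl

theorem legs_antisymmOp_zero (μ : ℂ) :
    legs (antisymmOp q μ R k) (k + 1) 0 = antisymm q μ (legs R.1 (k + 1)) k := by
  have := legs_antisymm (q := q) (μ := μ) R.1 (n := k + 1) (m := k) (j := k) (s := 0) (t := 0)
    (by omega) (by omega)
  simp only [zero_add] at this
  exact this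

end Main

/-! ### The operators O, Õ and the quantum determinant -/

section Main
variable {N k : ℕ} {q : ℂ} {R F : (TensorOp N 2 ℂ)ˣ}

/-- The data of a rank one antisymmetrizer: `a^{(k)↑1} = U V` with `V U = 1`. -/
theorem IsOrthogonal.exists_factorization (hR : IsOrthogonal q k R) :
    ∃ u v : (Fin k → Fin N) → ℂ, antisymmOp q (muO q k) R k = vecMulVec u v ∧ v ⬝ᵥ u = 1 ∧
      antisymmShiftOp q (muO q k) R k = tailCol u * (tailCol v)ᵀ ∧
      (tailCol v)ᵀ * tailCol u = 1 := by
  obtain ⟨u, v, huv, hvu⟩ := exists_vecMulVec_of_rank_eq_one hR.rank_one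
    (antisymmOp_idem hR.height.generic hR.height.bmw.relations)
  refine ⟨u, v, huv, hvu, ?_, tailCol_transpose_mul_tailCol hvu⟩
  rw [antisymmShiftOp_eq_legs, huv, legs_vecMulVec]

theorem descending_mul_antisymmShiftOp (h : IsCompatiblePair R F) (μ : ℂ) :
    ((List.range k).reverse.map (legs F.1 (k + 1))).prod * antisymmShiftOp q μ R k =
      legs (antisymmOp q μ R k) (k + 1) 0 *
        ((List.range k).reverse.map (legs F.1 (k + 1))).prod := by
  rw [legs_antisymmOp_zero]
  exact antisymm_semiconjBy k fun i hi =>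
    (h.twisted_left (k + 1)).semiconjBy_descending k (by omega) hi

theorem ascending_mul_antisymmOp (h : IsCompatiblePair R F) (μ : ℂ) :
    ((List.range k).map (legs F.1 (k + 1))).prod * legs (antisymmOp q μ R k) (k + 1) 0 =
      antisymmShiftOp q μ R k * ((List.range k).map (legs F.1 (k + 1))).prod := by
  rw [legs_antisymmOp_zero]
  exact antisymm_semiconjBy k fun i hi =>
    (h.twisted_left (k + 1)).semiconjBy_ascending k (by omega) hi

theorem descending_mul_inv (F : (TensorOp N 2 ℂ)ˣ) (k : ℕ) :
    ((List.range k).reverse.map (legs F.1 (k + 1))).prod *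
      ((List.range k).map (legs (F⁻¹).1 (k + 1))).prod = 1 :=
  prod_range_reverse_mul_prod_range k fun i hi => by
    rw [← legs_mul _ _ (by omega), Units.mul_inv, legs_one (by omega)]

theorem ascending_mul_inv (F : (TensorOp N 2 ℂ)ˣ) (k : ℕ) :
    ((List.range k).map (legs F.1 (k + 1))).prod *
      ((List.range k).reverse.map (legs (F⁻¹).1 (k + 1))).prod = 1 :=
  prod_range_mul_prod_range_reverse k fun i hi => by
    rw [← legs_mul _ _ (by omega), Units.mul_inv, legs_one (by omega)]

theorem opOInv_mul_opO (hRF : IsCompatiblePair R F) (hR : IsOrthogonal q k R) :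
    opOInv q k R F * opO q k R F = 1 := by
  obtain ⟨u, v, -, -, ha, hVU⟩ := hR.exists_factorization
  have hmid := hR.shift_mul_mul_shift
  have hΘ := descending_mul_antisymmShiftOp (q := q) (k := k) hRF (muO q k)
  have hΘ' := descending_mul_inv F k
  rw [opOInv, opO]
  generalize ((List.range k).reverse.map (legs F.1 (k + 1))).prod = Θ at *
  generalize ((List.range k).map (legs (F⁻¹).1 (k + 1))).prod = Θ' at *
  generalize legs (antisymmOp q (muO q k) R k) (k + 1) 0 = a₁ at *
  rw [ha] at hmid hΘ ⊢
  rw [← Matrix.mul_assoc Θ, traceTail_mul_tailCol_transpose, Matrix.mul_assoc (tailCol u),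
    traceTail_tailCol_mul, Matrix.smul_mul, Matrix.mul_smul, smul_smul]
  generalize tailCol u = U at *
  generalize (tailCol v)ᵀ = V at *
  have h1 : V * (Θ * U) * (V * Θ' * U) = V * a₁ * U := by
    calc _ = V * (Θ * (U * V)) * Θ' * U := by simp only [Matrix.mul_assoc]
      _ = V * a₁ * (Θ * Θ') * U := by rw [hΘ]; simp only [Matrix.mul_assoc]
      _ = V * a₁ * U := by rw [hΘ', Matrix.mul_one]
  -- Inserting VU = 1 on both sides creates the sandwich a' a₁ a', to which the scalar identity
  -- applies.
  have h2 : V * a₁ * U = V * (U * V * a₁ * (U * V)) * U := by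
    calc _ = (V * U) * (V * a₁ * U) * (V * U) := by rw [hVU, Matrix.one_mul, Matrix.mul_one]
      _ = _ := by simp only [Matrix.mul_assoc]
  rw [h1, h2, ← Matrix.smul_mul, ← Matrix.mul_smul, hmid, ← Matrix.mul_assoc V, hVU,
    Matrix.one_mul, hVU]

/-- The product of k copies commutes with every R_i, hence with the rank one idempotent, on which it
acts as one element m. Taking the R-trace gives d as the R-trace of the antisymmetrizer. No
invertibility of d is needed, since a relation for m passes to its multiples. -/
theorem exists_quantumDet_factorization (hRF : IsCompatiblePair R F) (hR : IsOrthogonal q k R) :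
    ∃ (d : ℂ) (m : QMAlgebra R F), quantumDet q k R F hR.height.skew = d • m ∧
      ((List.range k).map (copy F (quantumMatrix R F) k)).prod *
          numeric (QMAlgebra R F) (antisymmOp q (muO q k) R k) =
        scalarOp _ m * numeric (QMAlgebra R F) (antisymmOp q (muO q k) R k) := by
  obtain ⟨u, v, huv, hvu, -, -⟩ := hR.exists_factorization
  have hk := hR.height.two_le
  have hc : Commute (numeric (QMAlgebra R F) (antisymmOp q (muO q k) R k))
      ((List.range k).map (copy F (quantumMatrix R F) k)).prod := by
    rw [antisymmOp, numeric_antisymm]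
    exact (antisymm_commute k fun i hi => ((Copies.comm_prod
      ((hRF.twisted_left k).map (numericHom _ (QMAlgebra R F)).toMonoidHom)
      ((hRF.twisted_right k).map (numericHom _ (QMAlgebra R F)).toMonoidHom)
      (copies_copy R.1 F _ k) (copies_copy F.1 F _ k) (quantumMatrix_relation_legs hk)
      k le_rfl hi).symm)).symm
  rw [huv] at hc
  obtain ⟨m, hm⟩ := exists_mul_numeric_eq_scalarOp hvu hc
  rw [← huv] at hm
  have hd := rTrace_scalarOp_mul (dMatrix R hR.height.skew) m (antisymmOp q (muO q k) R k)
  rw [← hm] at hd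
  exact ⟨_, m, hd, hm⟩

theorem quantumMatrix_mul_scalarOp (hRF : IsCompatiblePair R F) (hR : IsOrthogonal q k R)
    {m : QMAlgebra R F}
    (hm : ((List.range k).map (copy F (quantumMatrix R F) k)).prod *
          numeric (QMAlgebra R F) (antisymmOp q (muO q k) R k) =
        scalarOp _ m * numeric (QMAlgebra R F) (antisymmOp q (muO q k) R k)) :
    quantumMatrix R F * scalarOp _ m = scalarOp _ m * (coeffs (QMAlgebra R F) (opOInv q k R F) *
      quantumMatrix R F * coeffs (QMAlgebra R F) (opO q k R F)) := by
  obtain ⟨u, v, -, -, ha, hVU⟩ := hR.exists_factorization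
  have hk := hR.height.two_le
  have hmid := congrArg (numeric (QMAlgebra R F)) hR.shift_mul_mul_shift
  have hΘ := congrArg (numeric (QMAlgebra R F))
    (descending_mul_antisymmShiftOp (q := q) (k := k) hRF (muO q k))
  have hΦ := congrArg (numeric (QMAlgebra R F))
    (ascending_mul_antisymmOp (q := q) (k := k) hRF (muO q k))
  have hΦ' := congrArg (numeric (QMAlgebra R F)) (ascending_mul_inv F k)
  have tR := (hRF.twisted_left (k + 1)).map (numericHom _ (QMAlgebra R F)).toMonoidHom
  have tF := (hRF.twisted_right (k + 1)).map (numericHom _ (QMAlgebra R F)).toMonoidHom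
  have cR := copies_copy R.1 F (quantumMatrix R F) (k + 1)
  have cF := copies_copy F.1 F (quantumMatrix R F) (k + 1)
  have h0 := quantumMatrix_relation_legs (R := R) (F := F) (n := k + 1) (by omega)
  have hcomm : ∀ i, i + 1 < k + 1 → Commute (numeric (QMAlgebra R F) (legs R.1 (k + 1) i))
      ((List.range (k + 1)).map (copy F (quantumMatrix R F) (k + 1))).prod :=
    fun i hi => Copies.comm_prod tR tF cR cF h0 (k + 1) le_rfl hi
  have hca₂ : Commute (numeric (QMAlgebra R F) (antisymmShiftOp q (muO q k) R k))
      ((List.range (k + 1)).map (copy F (quantumMatrix R F) (k + 1))).prod := by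
    rw [antisymmShiftOp, numeric_antisymm]
    exact (antisymm_commute k fun i hi => (hcomm (i + 1) (by omega)).symm).symm
  have hck : Commute (numeric (QMAlgebra R F) (legs (antisymmOp q (muO q k) R k) (k + 1) 0))
      (copy F (quantumMatrix R F) (k + 1) k) := by
    rw [legs_antisymmOp_zero, numeric_antisymm]
    exact (antisymm_commute k fun i hi =>
      (Copies.comm_of_add_two_le tR cR (by omega) (by omega)).symm).symm
  have hlast := prod_range_succ (copy F (quantumMatrix R F) (k + 1)) k
  have hfirst : ((List.range (k + 1)).map (copy F (quantumMatrix R F) (k + 1))).prod =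
      copy F (quantumMatrix R F) (k + 1) 0 *
        ((List.range k).map fun i => copy F (quantumMatrix R F) (k + 1) (i + 1)).prod := by
    simp [List.range_succ_eq_map, Function.comp_def]
  have hconj : SemiconjBy ((List.range k).map fun i => numeric (QMAlgebra R F)
        (legs F.1 (k + 1) i)).prod
      ((List.range k).map (copy F (quantumMatrix R F) (k + 1))).prod
      ((List.range k).map fun i => copy F (quantumMatrix R F) (k + 1) (i + 1)).prod :=
    semiconjBy_prod_range k fun i hi => Copies.ascending_mul tF cF k (by omega) hi
  have hMk := cF.eq_conj k (by omega)
  have hm' := congrArg (fun X => legs X (k + 1) 0) hm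
  have hprod : legs ((List.range k).map (copy F (quantumMatrix R F) k)).prod (k + 1) 0 =
      ((List.range k).map (copy F (quantumMatrix R F) (k + 1))).prod := by
    rw [← legsHom_apply (by omega : 0 + k ≤ k + 1), map_list_prod, List.map_map]
    congr 1
    refine List.map_congr_left fun i hi => ?_
    exact legs_copy _ (by omega) i (List.mem_range.mp hi)
  rw [legs_mul _ _ (by omega), hprod, legs_scalarOp_mul, ← numeric_legs] at hm'
  have hM0' := tailCol_transpose_mul_legs_oneLeg (k := k) (quantumMatrix R F) v
  rw [← copy_zero (F := F)] at hM0'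
  rw [opOInv, opO, coeffs_eq_numeric, coeffs_eq_numeric]
  rw [← numeric_prod, ← numeric_prod] at hMk
  rw [← numeric_prod] at hconj
  generalize ((List.range k).reverse.map (legs F.1 (k + 1))).prod = Θ at *
  generalize ((List.range k).map (legs (F⁻¹).1 (k + 1))).prod = Θ' at *
  generalize ((List.range k).map (legs F.1 (k + 1))).prod = Φ at *
  generalize ((List.range k).reverse.map (legs (F⁻¹).1 (k + 1))).prod = Φ' at *
  generalize legs (antisymmOp q (muO q k) R k) (k + 1) 0 = a₁ at *
  rw [ha] at hmid hΘ hΦ hca₂ ⊢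
  rw [← Matrix.mul_assoc Θ, traceTail_mul_tailCol_transpose, Matrix.mul_assoc (tailCol u),
    traceTail_tailCol_mul]
  generalize tailCol u = U at *
  generalize (tailCol v)ᵀ = V at *
  generalize copy F (quantumMatrix R F) (k + 1) k = Mk at *
  generalize copy F (quantumMatrix R F) (k + 1) 0 = M₀ at *
  generalize ((List.range (k + 1)).map (copy F (quantumMatrix R F) (k + 1))).prod = T at *
  generalize ((List.range k).map (copy F (quantumMatrix R F) (k + 1))).prod = P at *
  generalize ((List.range k).map fun i => copy F (quantumMatrix R F) (k + 1) (i + 1)).prod = Q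
    at *
  have hVU' := congrArg (numeric (QMAlgebra R F)) hVU
  simp only [numeric_smul, numeric_mul, numeric_one] at *
  have hsU : scalarOp (Fin (k + 1) → Fin N) m * numeric (QMAlgebra R F) U =
    numeric (QMAlgebra R F) U * scalarOp (Fin N) m := scalarOp_mul_numeric m U
  have hsV : scalarOp (Fin N) m * numeric (QMAlgebra R F) V =
    numeric (QMAlgebra R F) V * scalarOp (Fin (k + 1) → Fin N) m := scalarOp_mul_numeric m V
  have hsΦ : scalarOp (Fin (k + 1) → Fin N) m * numeric (QMAlgebra R F) Φ =
    numeric (QMAlgebra R F) Φ * scalarOp (Fin (k + 1) → Fin N) m := scalarOp_mul_numeric m Φ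
  generalize numeric (QMAlgebra R F) U = nU at *
  generalize numeric (QMAlgebra R F) V = nV at *
  generalize numeric (QMAlgebra R F) Θ = nΘ at *
  generalize numeric (QMAlgebra R F) Θ' = nΘ' at *
  generalize numeric (QMAlgebra R F) Φ = nΦ at *
  generalize numeric (QMAlgebra R F) Φ' = nΦ' at *
  generalize numeric (QMAlgebra R F) a₁ = b₁ at *
  generalize oFactor q k = c at *
  clear hm tR tF cR cF h0 hcomm hprod ha hVU
  generalize scalarOp (Fin (k + 1) → Fin N) m = S at *
  generalize scalarOp (Fin N) m = s at *
  -- Q, the copies 2..k+1, is the conjugate of P by Φ = F₁⋯F_k, and Φ carries a₁ to a'; so Q acts on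
  -- a' by the same element m.
  have hQ : Q * (nU * nV) = S * (nU * nV) := by
    calc Q * (nU * nV) = Q * (nU * nV * nΦ) * nΦ' := by
          rw [Matrix.mul_assoc Q, Matrix.mul_assoc _ nΦ, hΦ', Matrix.mul_one]
      _ = (Q * nΦ) * b₁ * nΦ' := by rw [← hΦ]; simp only [Matrix.mul_assoc]
      _ = nΦ * (P * b₁) * nΦ' := by rw [← hconj.eq]; simp only [Matrix.mul_assoc]
      _ = (nΦ * S) * b₁ * nΦ' := by rw [hm']; simp only [Matrix.mul_assoc]
      _ = S * (nΦ * b₁) * nΦ' := by rw [← hsΦ]; simp only [Matrix.mul_assoc]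
      _ = S * (nU * nV) * (nΦ * nΦ') := by rw [hΦ]; simp only [Matrix.mul_assoc]
      _ = _ := by rw [hΦ', Matrix.mul_one]
  -- T = P·M_k with M_k = ΘM₀Θ'. Since a₁ commutes with M_k it reaches P and gives m, and Θ carries
  -- a' to a₁.
  have h1 : s * (nV * (nΘ * nU) * quantumMatrix R F * (nV * nΘ' * nU)) =
      nV * T * b₁ * nU := by
    calc _ = s * nV * nΘ * (nU * (quantumMatrix R F * nV)) * nΘ' * nU := by
          simp only [Matrix.mul_assoc]
      _ = nV * S * (nΘ * (nU * nV)) * M₀ * nΘ' * nU := by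
          rw [← hM0', hsV]; simp only [Matrix.mul_assoc]
      _ = nV * (S * b₁) * (nΘ * M₀ * nΘ') * nU := by
          rw [hΘ]; simp only [Matrix.mul_assoc]
      _ = nV * P * (b₁ * Mk) * nU := by rw [← hm', ← hMk]; simp only [Matrix.mul_assoc]
      _ = nV * (P * Mk) * b₁ * nU := by rw [hck.eq]; simp only [Matrix.mul_assoc]
      _ = _ := by rw [hlast]
  -- Both outer insertions of VU = 1 end up around b₁ because T commutes with a' = UV.
  have h2 : nV * T * b₁ * nU = nV * T * (nU * nV * b₁ * (nU * nV)) * nU := by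
    calc nV * T * b₁ * nU = (nV * nU) * (nV * T * b₁ * nU) * (nV * nU) := by
          rw [hVU', Matrix.one_mul, Matrix.mul_one]
      _ = nV * (nU * nV * T) * b₁ * (nU * nV) * nU := by simp only [Matrix.mul_assoc]
      _ = _ := by rw [hca₂.eq]; simp only [Matrix.mul_assoc]
  -- The other splitting, T = M₀·Q: V slides past M₀ and turns it into M.
  have h3 : nV * T * (nU * nV) * nU = quantumMatrix R F * s := by
    calc nV * T * (nU * nV) * nU = nV * M₀ * (Q * (nU * nV)) * nU := by
          rw [hfirst]; simp only [Matrix.mul_assoc]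
      _ = quantumMatrix R F * (nV * (S * nU)) * (nV * nU) := by
          rw [hQ, hM0']; simp only [Matrix.mul_assoc]
      _ = quantumMatrix R F * ((nV * nU) * s) * (nV * nU) := by
          rw [hsU]; simp only [Matrix.mul_assoc]
      _ = _ := by rw [hVU', Matrix.one_mul, Matrix.mul_one]
  simp only [Matrix.smul_mul, Matrix.mul_smul, smul_smul]
  rw [h1, h2, ← h3]
  conv_lhs => rw [← hmid]
  simp only [Matrix.smul_mul, Matrix.mul_smul]

end Main
end OrthQM

theorem mainTheorem3 (N k : ℕ) (q : ℂ) (R F : (OrthQM.TensorOp N 2 ℂ)ˣ)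
    (hRF : OrthQM.IsCompatiblePair R F) (hR : OrthQM.IsOrthogonal q k R) :
    (∀ a b : Fin N,
      OrthQM.quantumMatrix R F a b * OrthQM.quantumDet q k R F hR.height.skew =
        OrthQM.quantumDet q k R F hR.height.skew *
          (OrthQM.coeffs (OrthQM.QMAlgebra R F) (OrthQM.opOInv q k R F)
            * OrthQM.quantumMatrix R F
            * OrthQM.coeffs (OrthQM.QMAlgebra R F) (OrthQM.opO q k R F)) a b) ∧
    (OrthQM.opO q k R F * OrthQM.opOInv q k R F = 1 ∧
      OrthQM.opOInv q k R F * OrthQM.opO q k R F = 1) := by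
  have hinv := OrthQM.opOInv_mul_opO hRF hR
  -- For square complex matrices a one-sided inverse is two-sided.
  refine ⟨fun a b => ?_, mul_eq_one_comm.mp hinv, hinv⟩
  obtain ⟨d, m, hd, hm⟩ := OrthQM.exists_quantumDet_factorization hRF hR
  have h := congrFun (congrFun (OrthQM.quantumMatrix_mul_scalarOp hRF hR hm) a) b
  rw [OrthQM.scalarOp, Matrix.mul_diagonal, Matrix.diagonal_mul] at h
  rw [hd, mul_smul_comm, smul_mul_assoc, h]
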